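/- Setting. A reader with $M$ transmit and $R$ receive antennas serves $K$ backscatter tags. For $1\le m\le M$, $1\le k\le K$, $1\le r\le R$, the forward coefficients $h^f_{mk}$ and the backward coefficients $h^b_{kr}$ are independent, $h^f_{mk},h^b_{kr}\sim\mathcal{CN}(0,\beta_k)$ with $\beta_k>0$. The backscatter channel of tag $k$ is the $R\times M$ matrix $\mathbf H_k=\mathbf h^b_k(\mathbf h^f_k)^T$. Fix $\delta_k\in(0,1]$ (power reflection coefficients), $P_{Ik}>0$ (incident powers), $p_k=\delta_kP_{Ik}$, the noise variance $\sigma^2>0$, the pilot power $p_{ce}>0$, the pilot length $D$, a matrix $\mathbf G\in\mathbb C^{D\times M}$ with $\mathbf G^H\mathbf G=\mathbf I_M$, $\mathbf B=Dp_{ce}\mathbf I_M$, and a cut-off $\tau>0$. The channel estimate $\widehat{\mathbf H}_k$ is one of the following. (LS) $\widehat{\mathbf H}_k=\mathbf Y_k\delta_k^{-1/2}\mathbf G^*\mathbf B^{-1/2}$, where $\mathbf Y_k=\sqrt{\delta_k}\,\mathbf H_k(\mathbf G\mathbf B^{1/2})^T+\mathbf N_k$ and the noise matrices $\mathbf N_k$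 have i.i.d. $\mathcal{CN}(0,\sigma^2)$ entries, independent of the channel coefficients; put $\sigma_{\tilde e,k}^2=\frac{\sigma^2}{Dp_{ce}\delta_k}$. (MMSE, modelled through its estimation error) $\widehat{\mathbf H}_k=\mathbf H_k+\widetilde{\mathbf E}_k$, where the entries of the matrices $\widetilde{\mathbf E}_k$ are independent of each other and of the channel coefficients, and those of $\widetilde{\mathbf E}_k$ are $\mathcal{CN}(0,\sigma_{\tilde e,k}^2)$ with $\sigma_{\tilde e,k}^2=\beta_k^2\big/\big(1+\frac{\delta_k\beta_k^2Dp_{ce}}{\sigma^2}\big)$. Fix $m$ and $k$. Let $\widehat{\mathbf h}_{mi}$ be the $m$-th column of $\widehat{\mathbf H}_i$, $\widehat{\mathbf H}_m=[\widehat{\mathbf h}_{m1},\dots,\widehat{\mathbf h}_{mK}]\in\mathbb C^{R\times K}$, $\widehat{\mathbf h}^b_i=\widehat{\mathbf h}_{mi}/h^f_{mi}$, and let $\mathbf q_k$ be the $k$-th column of the zero-forcing detector $\mathbf Q=\widehat{\mathbf H}_m(\widehat{\mathbf H}_m^H\widehat{\mathbf H}_m)^{-1}$. The SINR of tag $k$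 is $$\gamma_k=\frac{p_k|\mathbf q_k^H\widehat{\mathbf h}^b_k|^2}{\sum_{i\ne k}p_i|\mathbf q_k^H\widehat{\mathbf h}^b_i|^2+|\mathbf q_k^H\mathbf q_k|\sum_{i=1}^Kp_i\sigma_{\epsilon,mi}^2+|\mathbf q_k^H\mathbf q_k|\sigma^2},$$ where $\sigma^2_{\epsilon,mk}=\sigma^2_{\tilde e,k}/|h^f_{mk}|^2$ and, for the interfering tags $i\ne k$, gains below $\tau$ are left out: $\sigma^2_{\epsilon,mi}=\sigma^2_{\tilde e,i}/|h^f_{mi}|^2$ if $|h^f_{mi}|^2\ge\tau$, and $\sigma^2_{\epsilon,mi}=0$ otherwise (equivalently, $\mathbb E\{1/|h^f_{mi}|^2\}$ is understood as $\int_\tau^\infty\frac1{\beta_ix}e^{-x/\beta_i}\,dx$). Statement. Let $R\ge K+1$. Then $\widehat{\mathbf H}_m^H\widehat{\mathbf H}_m$ is almost surely invertible, $1/\gamma_k$ and $\log_2(1+\gamma_k)$ are integrable, and the Jensen lower bound $\tilde R_k^{ZF}=\log_2\big(1+(\mathbb E\{1/\gamma_k\})^{-1}\big)$ on the ergodic rate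 satisfies $$\mathbb E\{\log_2(1+\gamma_k)\}\ \ge\ \tilde R_k^{ZF}=\log_2(1+\tilde\gamma_k^{ZF}),$$ $$\tilde\gamma_k^{ZF}=\frac{p_k(R-K)\beta_k}{(1-\phi)\Big(\sum_{i\ne k}p_i\frac{\sigma_{\tilde e,i}^2}{\beta_i}\Gamma\big(0,\tfrac{\tau}{\beta_i}\big)+\sigma^2\Big)+p_k\beta_k\phi},$$ where $\phi=\mathbb E\Big\{\frac{1}{\beta_k|h^f_{mk}|^2/\sigma_{\tilde e,k}^2+1}\Big\}$ and $\Gamma(0,t)=\int_t^\infty u^{-1}e^{-u}\,du$. -/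

import Mathlib

open MeasureTheory ProbabilityTheory
open scoped Matrix

noncomputable section

namespace WPBC

/-- The circularly symmetric complex normal law `CN(0, v)`: real and imaginary part are independent
real Gaussians of mean `0` and variance `v / 2`, so that the mean of `|z|²` is `v`. -/
def complexGaussian (v : ℝ) : Measure ℂ :=
  ((gaussianReal 0 (v / 2).toNNReal).prod (gaussianReal 0 (v / 2).toNNReal)).map
    (fun x : ℝ × ℝ => (⟨x.1, x.2⟩ : ℂ))

/-- `X i`, `i : ι`, are jointly independent with `X i ∼ CN(0, v i)`. -/
structure IsIndepCN {Ω ι : Type*} [MeasurableSpace Ω] (X : ι → Ω → ℂ) (v : ι → ℝ)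
    (μ : Measure Ω) : Prop where
  law : ∀ i, HasLaw (X i) (complexGaussian (v i)) μ
  indep : iIndepFun X μ

/-- The incomplete Gamma function `Γ(0, t) = ∫_t^∞ u⁻¹ e^{-u} du` (used for `t > 0`). -/
def gammaZero (t : ℝ) : ℝ := ∫ u in Set.Ioi t, u⁻¹ * Real.exp (-u)

/-- Deterministic parameters of the system with `K` tags. -/
structure Params (K : ℕ) where
  /-- path loss of tag `k` -/
  β : Fin K → ℝ
  /-- power reflection coefficient of tag `k` -/
  δ : Fin K → ℝ
  /-- incident signal power of tag `k` -/
  PI : Fin K → ℝ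
  /-- noise variance `σ²` at the reader -/
  σ2 : ℝ
  /-- pilot power per antenna -/
  pce : ℝ
  /-- length of the pilot sequences -/
  D : ℕ
  /-- cut-off of the forward channel gains of the interfering tags -/
  τ : ℝ
  β_pos : ∀ k, 0 < β k
  δ_pos : ∀ k, 0 < δ k
  δ_le_one : ∀ k, δ k ≤ 1
  PI_pos : ∀ k, 0 < PI k
  σ2_pos : 0 < σ2
  pce_pos : 0 < pce
  τ_pos : 0 < τ

/-- The two channel estimation methods. -/
inductive Method where
  | LS
  | MMSE

variable {K M R : ℕ} {Ω : Type*} [MeasurableSpace Ω]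

/-- Reflected power `p_k = δ_k P_{Ik}`. -/
def Params.p (P : Params K) (k : Fin K) : ℝ := P.δ k * P.PI k

/-- Variance of the estimation error of the entries of the backscatter channel of tag `k`. -/
def Params.errVar (P : Params K) : Method → Fin K → ℝ
  | .LS, k => P.σ2 / (P.D * P.pce * P.δ k)
  | .MMSE, k => P.β k ^ 2 / (1 + P.δ k * P.β k ^ 2 * P.D * P.pce / P.σ2)

/-- Backscatter channel `H_k = h_k^b (h_k^f)^T` of tag `k`, an `R × M` matrix. -/
def backscatter (hf : Fin M → Fin K → Ω → ℂ) (hb : Fin K → Fin R → Ω → ℂ) (k : Fin K) (ω : Ω) :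
    Matrix (Fin R) (Fin M) ℂ :=
  Matrix.vecMulVec (fun r => hb k r ω) (fun m => hf m k ω)

/-- `B^{1/2}`, where `B` is diagonal with diagonal entries `D p_ce`. -/
def Params.sqrtB (P : Params K) (M : ℕ) : Matrix (Fin M) (Fin M) ℂ :=
  Matrix.diagonal fun _ => ((Real.sqrt (P.D * P.pce) : ℝ) : ℂ)

/-- Received pilot signal `Y_k = √δ_k H_k (G B^{1/2})^T + N_k` of tag `k`. -/
def pilotSignal (P : Params K) (G : Matrix (Fin P.D) (Fin M) ℂ)
    (k : Fin K) (H : Matrix (Fin R) (Fin M) ℂ) (N : Matrix (Fin R) (Fin P.D) ℂ) :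
    Matrix (Fin R) (Fin P.D) ℂ :=
  ((Real.sqrt (P.δ k) : ℝ) : ℂ) • (H * (G * P.sqrtB M)ᵀ) + N

/-- Least squares estimate `Y_k δ_k^{-1/2} G^* B^{-1/2}`, with `G^*` the entrywise conjugate. -/
def lsEstimate (P : Params K) (G : Matrix (Fin P.D) (Fin M) ℂ)
    (k : Fin K) (Y : Matrix (Fin R) (Fin P.D) ℂ) : Matrix (Fin R) (Fin M) ℂ :=
  ((Real.sqrt (P.δ k) : ℝ) : ℂ)⁻¹ • (Y * G.map star * (P.sqrtB M)⁻¹)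

/-- `Hhat` is the estimated backscatter channel obtained by the given method, together with the
law of all the random objects involved.
In both cases the forward coefficients `hf m k`, the backward coefficients `hb k r` (both
`CN(0, β_k)`) and the noise (resp. error) entries are jointly independent.
* LS: the estimate is computed from the received pilots, with `CN(0, σ²)` receiver noise.
* MMSE: `Hhat_k = H_k + E_k`, with an error `E_k` that has `CN(0, σ_{ẽ,k}²)` entries. -/
def IsEstimate (P : Params K) (G : Matrix (Fin P.D) (Fin M) ℂ)
    (hf : Fin M → Fin K → Ω → ℂ) (hb : Fin K → Fin R → Ω → ℂ)
    (Hhat : Fin K → Ω → Matrix (Fin R) (Fin M) ℂ) (μ : Measure Ω) : Method → Prop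
  | .LS => ∃ N : Fin K → Fin R → Fin P.D → Ω → ℂ,
      IsIndepCN
        (Sum.elim (fun x : Fin M × Fin K => hf x.1 x.2)
          (Sum.elim (fun x : Fin K × Fin R => hb x.1 x.2)
            (fun x : Fin K × Fin R × Fin P.D => N x.1 x.2.1 x.2.2)))
        (Sum.elim (fun x => P.β x.2) (Sum.elim (fun x => P.β x.1) (fun _ => P.σ2))) μ ∧
      ∀ k ω, Hhat k ω =
        lsEstimate P G k
          (pilotSignal P G k (backscatter hf hb k ω) (Matrix.of fun r d => N k r d ω))
  | .MMSE => ∃ E : Fin K → Fin R → Fin M → Ω → ℂ,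
      IsIndepCN
        (Sum.elim (fun x : Fin M × Fin K => hf x.1 x.2)
          (Sum.elim (fun x : Fin K × Fin R => hb x.1 x.2)
            (fun x : Fin K × Fin R × Fin M => E x.1 x.2.1 x.2.2)))
        (Sum.elim (fun x => P.β x.2)
          (Sum.elim (fun x => P.β x.1) (fun x => P.errVar .MMSE x.1))) μ ∧
      ∀ k ω, Hhat k ω = backscatter hf hb k ω + Matrix.of fun r m => E k r m ω

/-- `Ĥ_m = [ĥ_{m1}, …, ĥ_{mK}]`, the `R × K` matrix of the estimated backscatter channels from the
transmit antenna `m`. -/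
def antennaEstimate (Hhat : Fin K → Ω → Matrix (Fin R) (Fin M) ℂ) (m : Fin M) (ω : Ω) :
    Matrix (Fin R) (Fin K) ℂ :=
  Matrix.of fun r k => Hhat k ω r m

/-- The zero-forcing detector `Q = Ĥ (Ĥ^H Ĥ)⁻¹`. -/
def zfDetector (A : Matrix (Fin R) (Fin K) ℂ) : Matrix (Fin R) (Fin K) ℂ :=
  A * (Aᴴ * A)⁻¹

/-- The column `q_k` of the zero-forcing detector. -/
def zfColumn (Hhat : Fin K → Ω → Matrix (Fin R) (Fin M) ℂ) (m : Fin M) (k : Fin K) (ω : Ω) :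
    Fin R → ℂ :=
  (zfDetector (antennaEstimate Hhat m ω)).col k

/-- The estimated backward channel `ĥ_k^b = ĥ_{mk} / h_{mk}^f`. -/
def backwardEstimate (hf : Fin M → Fin K → Ω → ℂ) (Hhat : Fin K → Ω → Matrix (Fin R) (Fin M) ℂ)
    (m : Fin M) (k : Fin K) (ω : Ω) : Fin R → ℂ :=
  fun r => antennaEstimate Hhat m ω r k / hf m k ω

/-- The error variance `σ_{ε,mi}²(h) = σ_{ẽ,i}² / |h|²` of the backward channel, given the forward
channel `h`, where `s = σ_{ẽ,i}²`. -/
def backwardErrVar (s : ℝ) (h : ℂ) : ℝ := s / ‖h‖ ^ 2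

/-- The error variance of the backward channel counted on forward gains `|h|² ≥ τ` only. -/
def cutErrVar (τ s : ℝ) (h : ℂ) : ℝ := if τ ≤ ‖h‖ ^ 2 then backwardErrVar s h else 0

/-- Signal power `p_k |q_k^H ĥ_k^b|²`. -/
def signalPower (P : Params K) (hf : Fin M → Fin K → Ω → ℂ)
    (Hhat : Fin K → Ω → Matrix (Fin R) (Fin M) ℂ) (m : Fin M) (k : Fin K) (ω : Ω) : ℝ :=
  P.p k * ‖star (zfColumn Hhat m k ω) ⬝ᵥ backwardEstimate hf Hhat m k ω‖ ^ 2

/-- Power of interference, estimation errors and noise,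
`∑_{i ≠ k} p_i |q_k^H ĥ_i^b|² + |q_k^H q_k| ∑_i p_i σ_{ε,mi}² + |q_k^H q_k| σ²`,
where the error variances of the interfering tags `i ≠ k` are cut off at gain `τ`. -/
def noisePower (P : Params K) (method : Method) (hf : Fin M → Fin K → Ω → ℂ)
    (Hhat : Fin K → Ω → Matrix (Fin R) (Fin M) ℂ) (m : Fin M) (k : Fin K) (ω : Ω) : ℝ :=
  let q := zfColumn Hhat m k ω
  ∑ i ∈ Finset.univ.erase k, P.p i * ‖star q ⬝ᵥ backwardEstimate hf Hhat m i ω‖ ^ 2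
    + ‖star q ⬝ᵥ q‖ *
      (∑ i ∈ Finset.univ.erase k, P.p i * cutErrVar P.τ (P.errVar method i) (hf m i ω)
        + P.p k * backwardErrVar (P.errVar method k) (hf m k ω))
    + ‖star q ⬝ᵥ q‖ * P.σ2

/-- The instantaneous SINR `γ_k`. -/
def sinr (P : Params K) (method : Method) (hf : Fin M → Fin K → Ω → ℂ)
    (Hhat : Fin K → Ω → Matrix (Fin R) (Fin M) ℂ) (m : Fin M) (k : Fin K) (ω : Ω) : ℝ :=
  signalPower P hf Hhat m k ω / noisePower P method hf Hhat m k ω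

/-- The random variable inside the expectation of the Jensen bound, the inverse of the SINR. -/
def invSinr (P : Params K) (method : Method) (hf : Fin M → Fin K → Ω → ℂ)
    (Hhat : Fin K → Ω → Matrix (Fin R) (Fin M) ℂ) (m : Fin M) (k : Fin K) (ω : Ω) : ℝ :=
  noisePower P method hf Hhat m k ω / signalPower P hf Hhat m k ω

/-- The ergodic rate `R_k = E{log₂(1 + γ_k)}`. -/
def ergodicRate (P : Params K) (method : Method) (hf : Fin M → Fin K → Ω → ℂ)
    (Hhat : Fin K → Ω → Matrix (Fin R) (Fin M) ℂ) (m : Fin M) (k : Fin K) (μ : Measure Ω) : ℝ :=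
  ∫ ω, Real.logb 2 (1 + sinr P method hf Hhat m k ω) ∂μ

/-- The Jensen lower bound `R̃_k = log₂(1 + (E{1/γ_k})⁻¹)`. -/
def jensenRate (P : Params K) (method : Method) (hf : Fin M → Fin K → Ω → ℂ)
    (Hhat : Fin K → Ω → Matrix (Fin R) (Fin M) ℂ) (m : Fin M) (k : Fin K) (μ : Measure Ω) : ℝ :=
  Real.logb 2 (1 + (∫ ω, invSinr P method hf Hhat m k ω ∂μ)⁻¹)

/-- `φ = E{1 / (β_k |h|² / σ_{ẽ,k}² + 1)}` with `h ∼ CN(0, β_k)`. -/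
def phi (P : Params K) (method : Method) (k : Fin K) : ℝ :=
  ∫ h, 1 / (P.β k * ‖h‖ ^ 2 / P.errVar method k + 1) ∂(complexGaussian (P.β k))

/-- The closed-form zero-forcing SINR `γ̃_k^{ZF}` with `R` receive antennas. -/
def zfSinr (P : Params K) (method : Method) (R : ℕ) (k : Fin K) : ℝ :=
  P.p k * ((R : ℝ) - K) * P.β k /
    ((1 - phi P method k) *
        (∑ i ∈ Finset.univ.erase k,
            P.p i * (P.errVar method i / P.β i) * gammaZero (P.τ / P.β i) + P.σ2)
      + P.p k * P.β k * phi P method k)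

end WPBC

end

namespace WPBC

variable {K M R : ℕ} {Ω : Type*} [MeasurableSpace Ω] {μ : Measure Ω}

/-! Write `a i` for the column of tag `i` in the estimate at antenna `m`, `h i` for its forward
coefficient and `s i` for its error variance. Zero forcing makes `q_k` orthogonal to every `a i`
with `i ≠ k` and normalises its product with `a k` to 1. The interference therefore vanishes and the
inverse SINR factors as `‖q_k‖² * noiseFactor`, where the second factor depends on the forward
coefficients only (`invSinr_eq`).

Conditionally on the forward coefficients, both estimators give independent `CN(0, β i |h i|² + s
i)` entries (`IsEstimate.exists_eq_add_sum`, `IsIndepCN.lintegral_estimate`). Moreover `‖q_k‖⁻²` is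
the squared norm of the projection of `a k` orthogonal to the other columns. This complement almost
surely has dimension `R - K + 1`, and the projection has that many independent Gaussian coordinates.
Writing `1/x` as `∫ exp (-t x) dt` gives the conditional mean `1 / ((β k |h k|² + s k)(R - K))` of
`‖q_k‖²` (`lintegral_zfNoiseGain`); it is finite because `R - K ≥ 1`.

It remains to average `noiseFactor` times this mean over the forward coefficients
(`integral_noiseFactor_div`). The ratio `|h k|² / (β k |h k|² + s k)` has mean `(1 - φ) / β k` and
is independent of the cut-off terms of the other tags, whose means are incomplete Gamma values. The
lower bound on the rate is Jensen's inequality for the convex function `x ↦ log (1 + 1/x)`. -/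

/-! ### The complex normal law: characteristic function, density, moments. -/

instance complexGaussian.isProbabilityMeasure (v : ℝ) :
    IsProbabilityMeasure (complexGaussian v) :=
  Measure.isProbabilityMeasure_map Complex.measurableEquivRealProd.symm.measurable.aemeasurable

theorem complexGaussian_eq_map_measurableEquiv (v : ℝ) :
    complexGaussian v = ((gaussianReal 0 (v / 2).toNNReal).prod
      (gaussianReal 0 (v / 2).toNNReal)).map Complex.measurableEquivRealProd.symm := rfl

/-- Real and imaginary parts are independent, so the transform is a product of two real ones. It
identifies the laws of linear images in `map_mulVec_pi_complexGaussian`. -/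
theorem charFunDual_complexGaussian {v : ℝ} (hv : 0 ≤ v) (L : StrongDual ℝ ℂ) :
    charFunDual (complexGaussian v) L =
      Complex.exp (-((v / 4 * (L 1 ^ 2 + L Complex.I ^ 2) : ℝ) : ℂ)) := by
  have hL : ∀ x : ℝ × ℝ, L (Complex.measurableEquivRealProd.symm x) = x.1 * L 1 + x.2 * L Complex.I := by
    intro x
    have : Complex.measurableEquivRealProd.symm x = x.1 • (1 : ℂ) + x.2 • Complex.I := by
      apply Complex.ext <;> simp [Complex.measurableEquivRealProd_symm_apply]
    rw [this, map_add, map_smul, map_smul, smul_eq_mul, smul_eq_mul]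
  have hc : ∀ t : ℝ, ∫ x : ℝ, Complex.exp (x * t * Complex.I) ∂(gaussianReal 0 (v / 2).toNNReal)
      = Complex.exp (-((v / 4 * t ^ 2 : ℝ) : ℂ)) := by
    intro t
    have h := charFun_gaussianReal (μ := 0) (v := (v / 2).toNNReal) t
    rw [charFun_apply_real] at h
    simp_rw [mul_comm (_ : ℂ) (t : ℂ)]
    rw [h]
    congr 1
    rw [Real.coe_toNNReal _ (by positivity)]
    push_cast
    ring
  rw [charFunDual_apply, complexGaussian_eq_map_measurableEquiv,
    integral_map_equiv]
  simp_rw [hL]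
  push_cast
  simp_rw [add_mul, Complex.exp_add]
  rw [integral_prod_mul (fun x : ℝ => Complex.exp (x * (L 1 : ℝ) * Complex.I))
    (fun x : ℝ => Complex.exp (x * (L Complex.I : ℝ) * Complex.I)), hc, hc, ← Complex.exp_add]
  congr 1
  push_cast
  ring

theorem complexGaussian_eq_withDensity {v : ℝ} (hv : 0 < v) :
    complexGaussian v = (volume : Measure ℂ).withDensity
      (fun z => ENNReal.ofReal ((Real.pi * v)⁻¹ * Real.exp (-(1 / v) * ‖z‖ ^ 2))) := by
  have hv' : (v / 2).toNNReal ≠ 0 := by simpa using hv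
  rw [complexGaussian_eq_map_measurableEquiv, gaussianReal_of_var_ne_zero _ hv',
    prod_withDensity (by fun_prop) (by fun_prop), ← Measure.volume_eq_prod]
  ext s hs
  rw [MeasurableEquiv.map_apply, withDensity_apply _ (MeasurableEquiv.measurable _ hs),
    withDensity_apply _ hs]
  have := (Complex.volume_preserving_equiv_real_prod.symm).setLIntegral_comp_preimage_emb
    (MeasurableEquiv.measurableEmbedding _)
    (fun z => ENNReal.ofReal ((Real.pi * v)⁻¹ * Real.exp (-(1 / v) * ‖z‖ ^ 2))) s
  rw [← this]
  congr 1
  ext x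
  rw [gaussianPDF, gaussianPDF, ← ENNReal.ofReal_mul (gaussianPDFReal_nonneg _ _ _)]
  congr 1
  simp only [gaussianPDFReal]
  rw [Real.coe_toNNReal _ (by positivity), mul_mul_mul_comm, ← Real.exp_add, ← mul_inv,
    Real.mul_self_sqrt (by positivity)]
  congr 2
  · ring
  · rw [Complex.sq_norm, Complex.normSq_apply, Complex.measurableEquivRealProd_symm_apply]
    field_simp
    ring

theorem complexGaussian_absolutelyContinuous {v : ℝ} (hv : 0 < v) :
    complexGaussian v ≪ volume := by
  rw [complexGaussian_eq_withDensity hv]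
  exact withDensity_absolutelyContinuous _ _

theorem ae_ne_zero_complexGaussian {v : ℝ} (hv : 0 < v) : ∀ᵐ z ∂complexGaussian v, z ≠ 0 :=
  (complexGaussian_absolutelyContinuous hv).ae_le (compl_mem_ae_iff.2 (measure_singleton 0))

theorem integral_complexGaussian {v : ℝ} (hv : 0 < v) (f : ℂ → ℝ) :
    ∫ z, f z ∂complexGaussian v = ∫ z, (Real.pi * v)⁻¹ * Real.exp (-(1 / v) * ‖z‖ ^ 2) * f z := by
  rw [complexGaussian_eq_withDensity hv,
    integral_withDensity_eq_integral_toReal_smul (by fun_prop) (by simp)]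
  congr 1
  ext z
  rw [ENNReal.toReal_ofReal (by positivity), smul_eq_mul]

theorem integral_exp_neg_mul_sq_norm_complexGaussian {v t : ℝ} (hv : 0 < v) (ht : 0 ≤ t) :
    ∫ z, Real.exp (-t * ‖z‖ ^ 2) ∂complexGaussian v = (1 + t * v)⁻¹ := by
  rw [integral_complexGaussian hv]
  have h : ∀ z : ℂ, (Real.pi * v)⁻¹ * Real.exp (-(1 / v) * ‖z‖ ^ 2) * Real.exp (-t * ‖z‖ ^ 2)
      = (Real.pi * v)⁻¹ * Real.exp (-(1 / v + t) * ‖z‖ ^ 2) := by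
    intro z
    rw [mul_assoc, ← Real.exp_add]
    ring_nf
  simp_rw [h]
  rw [integral_const_mul, GaussianFourier.integral_rexp_neg_mul_sq_norm (by positivity),
    Complex.finrank_real_complex]
  norm_num
  field_simp

theorem lintegral_sq_norm_complexGaussian {v : ℝ} (hv : 0 ≤ v) :
    ∫⁻ z, ENNReal.ofReal (‖z‖ ^ 2) ∂complexGaussian v = ENNReal.ofReal v := by
  have h1 : ∫⁻ x, ENNReal.ofReal (x ^ 2) ∂gaussianReal 0 (v / 2).toNNReal
      = ENNReal.ofReal (v / 2) := by
    have h := variance_id_gaussianReal (μ := 0) (v := (v / 2).toNNReal)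
    have hi : Integrable (fun x : ℝ => x ^ 2) (gaussianReal 0 (v / 2).toNNReal) :=
      (memLp_id_gaussianReal 2).integrable_sq
    rw [variance_eq_sub (memLp_id_gaussianReal 2)] at h
    simp only [id, Pi.pow_apply, integral_id_gaussianReal] at h
    rw [← ofReal_integral_eq_lintegral_ofReal hi (.of_forall fun x => sq_nonneg _)]
    rw [Real.coe_toNNReal _ (by positivity)] at h
    congr 1
    linarith
  rw [complexGaussian_eq_map_measurableEquiv, lintegral_map_equiv]
  have h2 : ∀ x : ℝ × ℝ, ENNReal.ofReal (‖Complex.measurableEquivRealProd.symm x‖ ^ 2)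
      = ENNReal.ofReal (x.1 ^ 2) + ENNReal.ofReal (x.2 ^ 2) := by
    intro x
    rw [← ENNReal.ofReal_add (by positivity) (by positivity), Complex.sq_norm,
      Complex.normSq_apply, Complex.measurableEquivRealProd_symm_apply, sq, sq]
  simp_rw [h2]
  rw [lintegral_add_left (by fun_prop), lintegral_prod _ (by fun_prop), lintegral_prod _ (by fun_prop)]
  simp only [lintegral_const, measure_univ, mul_one, h1]
  rw [← ENNReal.ofReal_add (by positivity) (by positivity), add_halves]

/-- Polar coordinates reduce to a radial integral, which the substitution `u = y² / v` turns into
the incomplete Gamma function. The cut-off is essential, since `1 / |z|²` is not integrable at the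
origin of the plane. -/
theorem integral_cutErrVar {v τ : ℝ} (hv : 0 < v) (hτ : 0 < τ) (s : ℝ) :
    ∫ z, cutErrVar τ s z ∂complexGaussian v = s / v * gammaZero (τ / v) := by
  rw [integral_complexGaussian hv]
  have h := integral_fun_norm_addHaar (volume : Measure ℂ)
    (fun r => (Real.pi * v)⁻¹ * Real.exp (-(1 / v) * r ^ 2) * (if τ ≤ r ^ 2 then s / r ^ 2 else 0))
  simp only [cutErrVar, backwardErrVar]
  rw [h, Complex.finrank_real_complex]
  have hb : (volume : Measure ℂ).real (Metric.ball 0 1) = Real.pi := by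
    simp [Measure.real, Complex.volume_ball]
  rw [hb]
  have h2 : gammaZero (τ / v) =
      ∫ y in Set.Ioi (0 : ℝ), if τ ≤ y ^ 2 then 2 * y⁻¹ * Real.exp (-(1 / v) * y ^ 2) else 0 := by
    have hset : (fun y : ℝ => y ^ 2 / v) '' Set.Ioi (Real.sqrt τ) = Set.Ioi (τ / v) := by
      ext x
      simp only [Set.mem_image, Set.mem_Ioi]
      constructor
      · rintro ⟨y, hy, rfl⟩
        have := (Real.sqrt_lt' (lt_of_le_of_lt (Real.sqrt_nonneg _) hy)).1 hy
        gcongr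
      · intro hx
        have hx' : τ < x * v := by rwa [div_lt_iff₀ hv] at hx
        refine ⟨Real.sqrt (x * v), Real.sqrt_lt_sqrt hτ.le hx', ?_⟩
        rw [Real.sq_sqrt (by linarith)]
        field_simp
    have hinj : Set.InjOn (fun y : ℝ => y ^ 2 / v) (Set.Ioi (Real.sqrt τ)) := by
      intro a ha b hb hab
      have ha' : 0 ≤ a := (Real.sqrt_nonneg τ).trans (le_of_lt ha)
      have hb' : 0 ≤ b := (Real.sqrt_nonneg τ).trans (le_of_lt hb)
      have : a ^ 2 = b ^ 2 := by
        have := congrArg (· * v) hab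
        simpa [hv.ne'] using this
      exact (sq_eq_sq₀ ha' hb').1 this
    have hd : ∀ y ∈ Set.Ioi (Real.sqrt τ),
        HasDerivWithinAt (fun y : ℝ => y ^ 2 / v) (2 * y / v) (Set.Ioi (Real.sqrt τ)) y := by
      intro y _
      simpa using ((hasDerivAt_pow 2 y).div_const v).hasDerivWithinAt
    rw [gammaZero, ← hset, integral_image_eq_integral_abs_deriv_smul measurableSet_Ioi hd hinj]
    have hind : (fun y : ℝ => if τ ≤ y ^ 2 then 2 * y⁻¹ * Real.exp (-(1 / v) * y ^ 2) else 0)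
        = Set.indicator {y : ℝ | τ ≤ y ^ 2} (fun y => 2 * y⁻¹ * Real.exp (-(1 / v) * y ^ 2)) := by
      ext y
      simp [Set.indicator_apply]
    have hm : MeasurableSet {y : ℝ | τ ≤ y ^ 2} := measurableSet_le (by fun_prop) (by fun_prop)
    rw [hind, setIntegral_indicator hm]
    have hint : Set.Ioi (0 : ℝ) ∩ {y : ℝ | τ ≤ y ^ 2} = Set.Ici (Real.sqrt τ) := by
      ext y
      simp only [Set.mem_inter_iff, Set.mem_Ioi, Set.mem_ofPred_eq, Set.mem_Ici]
      constructor
      · rintro ⟨h0, h1⟩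
        exact (Real.sqrt_le_left h0.le).2 h1
      · intro h1
        have h0 : 0 < y := (Real.sqrt_pos.2 hτ).trans_le h1
        exact ⟨h0, (Real.sqrt_le_left h0.le).1 h1⟩
    rw [hint, integral_Ici_eq_integral_Ioi]
    refine setIntegral_congr_fun measurableSet_Ioi fun y hy => ?_
    have hy0 : 0 < y := (Real.sqrt_pos.2 hτ).trans hy
    simp only [smul_eq_mul]
    rw [abs_of_pos (by positivity)]
    have : -(y ^ 2 / v) = -(1 / v) * y ^ 2 := by ring
    rw [this]
    field_simp
  rw [h2, ← integral_const_mul, nsmul_eq_mul, smul_eq_mul, ← mul_assoc, ← integral_const_mul]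
  refine setIntegral_congr_fun measurableSet_Ioi fun y hy => ?_
  have hy0 : (0 : ℝ) < y := hy
  have hpi := Real.pi_pos
  simp only [smul_eq_mul]
  split_ifs
  · push_cast
    norm_num
    field_simp
  · simp

/-! ### Linear images of independent complex Gaussians. -/

/-- A linear map that turns the covariance `diag v` into `diag w` maps a vector of independent
`CN(0, v i)` variables to a vector of independent `CN(0, w j)` variables. -/
theorem map_mulVec_pi_complexGaussian {ι κ : Type*} [Fintype ι] [Fintype κ] [DecidableEq ι]
    [DecidableEq κ] {v : ι → ℝ} {w : κ → ℝ} (hv : ∀ i, 0 ≤ v i) (hw : ∀ j, 0 ≤ w j)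
    (C : Matrix κ ι ℂ)
    (hC : C * Matrix.diagonal (fun i => (v i : ℂ)) * Cᴴ = Matrix.diagonal (fun j => (w j : ℂ))) :
    (Measure.pi fun i => complexGaussian (v i)).map (fun x => C *ᵥ x)
      = Measure.pi fun j => complexGaussian (w j) := by
  let T : (ι → ℂ) →L[ℝ] (κ → ℂ) := (C.mulVecLin.restrictScalars ℝ).toContinuousLinearMap
  have hT : ∀ x, T x = C *ᵥ x := fun x => rfl
  change (Measure.pi fun i => complexGaussian (v i)).map T = _
  have := Measure.isProbabilityMeasure_map (μ := Measure.pi fun i => complexGaussian (v i))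
    T.continuous.measurable.aemeasurable
  apply Measure.ext_of_charFunDual
  ext L
  rw [charFunDual_map, charFunDual_pi, charFunDual_pi]
  simp_rw [charFunDual_complexGaussian (hv _), charFunDual_complexGaussian (hw _),
    ← Complex.exp_sum]
  congr 1
  rw [Finset.sum_neg_distrib, Finset.sum_neg_distrib, ← Complex.ofReal_sum, ← Complex.ofReal_sum]
  congr 2
  -- The complex vector `d` represents the real functional as `L y = Re (d ⬝ᵥ y)`, so that `C` acts
  -- on it by `d ᵥ* C`.
  set d : κ → ℂ := fun j => ⟨L (Pi.single j 1), -L (Pi.single j Complex.I)⟩ with hd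
  have hL : ∀ y : κ → ℂ, L y = (d ⬝ᵥ y).re := by
    intro y
    have hy : y = ∑ j, ((y j).re • (Pi.single j (1 : ℂ) : κ → ℂ)
        + (y j).im • (Pi.single j Complex.I : κ → ℂ)) := by
      ext l
      rw [Finset.sum_apply, Finset.sum_eq_single l]
      · apply Complex.ext <;> simp
      · intro b _ hb
        simp [hb.symm]
      · simp
    conv_lhs => rw [hy]
    simp only [map_sum, map_add, map_smul, smul_eq_mul, dotProduct, Complex.re_sum,
      Complex.mul_re, hd]
    exact Finset.sum_congr rfl fun j _ => by ring
  have key : ∀ n : ℂ, n.re ^ 2 + (n * Complex.I).re ^ 2 = Complex.normSq n := by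
    intro n
    rw [Complex.normSq_apply]
    simp
    ring
  have h1 : ∀ i, ((L ∘L T) ∘L ContinuousLinearMap.single ℝ (fun _ => ℂ) i) 1 ^ 2
      + ((L ∘L T) ∘L ContinuousLinearMap.single ℝ (fun _ => ℂ) i) Complex.I ^ 2
      = Complex.normSq ((d ᵥ* C) i) := by
    intro i
    rw [← key]
    simp only [ContinuousLinearMap.comp_apply, ContinuousLinearMap.single_apply, hT, hL,
      Matrix.dotProduct_mulVec, dotProduct_single, mul_one]
  have h2 : ∀ j, (L ∘L ContinuousLinearMap.single ℝ (fun _ => ℂ) j) 1 ^ 2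
      + (L ∘L ContinuousLinearMap.single ℝ (fun _ => ℂ) j) Complex.I ^ 2
      = Complex.normSq (d j) := by
    intro j
    rw [← key]
    simp only [ContinuousLinearMap.comp_apply, ContinuousLinearMap.single_apply, hL,
      dotProduct_single, mul_one]
  simp_rw [h1, h2]
  -- The covariance identity, evaluated as a quadratic form at `d`, is the equality of the two
  -- exponents: `∑ v i |(d ᵥ* C) i|² = ∑ w j |d j|²`.
  have h3 := congrArg (fun N : Matrix κ κ ℂ => d ⬝ᵥ (N *ᵥ star d)) hC
  simp only [← Matrix.mulVec_mulVec] at h3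
  rw [Matrix.dotProduct_mulVec, ← Matrix.star_vecMul] at h3
  simp only [dotProduct, Matrix.mulVec_diagonal, Pi.star_apply] at h3
  have h4 : ∀ (r : ℝ) (z : ℂ), z * (r * star z) = ((r * Complex.normSq z : ℝ) : ℂ) := by
    intro r z
    push_cast
    rw [Complex.normSq_eq_conj_mul_self, Complex.star_def]
    ring
  simp_rw [h4, ← Complex.ofReal_sum] at h3
  have h5 := Complex.ofReal_injective h3
  simp_rw [div_mul_eq_mul_div, ← Finset.sum_div]
  rw [h5]

/-! ### Inverse moments of squared Gaussian norms. -/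

/-- This trades an inverse squared norm for exponentials, which factor over the coordinates. In
`ENNReal` it persists at `x = 0`, where both sides are infinite. -/
theorem lintegral_exp_neg_mul_Ioi (x : ℝ) (hx : 0 ≤ x) :
    ∫⁻ t in Set.Ioi (0 : ℝ), ENNReal.ofReal (Real.exp (-t * x)) = (ENNReal.ofReal x)⁻¹ := by
  rcases hx.eq_or_lt with rfl | hx
  · simp
  · have h : ∀ t : ℝ, -t * x = -x * t := fun t => by ring
    simp_rw [h]
    rw [← ofReal_integral_eq_lintegral_ofReal (integrableOn_exp_mul_Ioi (by linarith) 0)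
      (.of_forall fun t => by positivity), integral_exp_mul_Ioi (by linarith),
      ← ENNReal.ofReal_inv_of_pos hx]
    simp

/-- A primitive is `-(1 + t v)⁻ⁿ / (v n)`. For `n = 0` the integral diverges; in the application `n
= R - K`. -/
theorem lintegral_inv_one_add_mul_pow_Ioi {v : ℝ} (hv : 0 < v) {n : ℕ} (hn : n ≠ 0) :
    ∫⁻ t in Set.Ioi (0 : ℝ), ENNReal.ofReal ((1 + t * v)⁻¹ ^ (n + 1))
      = ENNReal.ofReal (v * n)⁻¹ := by
  have hn' : (0 : ℝ) < n := by exact_mod_cast Nat.pos_of_ne_zero hn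
  have hd : ∀ t ∈ Set.Ici (0 : ℝ), HasDerivAt (fun t => -(v * n)⁻¹ * (1 + t * v)⁻¹ ^ n)
      ((1 + t * v)⁻¹ ^ (n + 1)) t := by
    intro t ht
    have ht' : (0 : ℝ) ≤ t := ht
    have h0 : 1 + t * v ≠ 0 := by positivity
    have h1 : HasDerivAt (fun t => 1 + t * v) v t := by
      simpa using ((hasDerivAt_id t).mul_const v).const_add 1
    refine (((h1.inv h0).pow n).const_mul (-(v * n)⁻¹)).congr_deriv ?_
    obtain ⟨j, rfl⟩ := Nat.exists_eq_succ_of_ne_zero hn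
    simp only [Nat.succ_eq_add_one, Nat.add_sub_cancel, Pi.inv_apply, inv_pow]
    field_simp
    ring
  have hpos : ∀ t ∈ Set.Ioi (0 : ℝ), 0 ≤ (1 + t * v)⁻¹ ^ (n + 1) := by
    intro t ht
    have ht' : (0 : ℝ) < t := ht
    positivity
  have hlim : Filter.Tendsto (fun t => -(v * n)⁻¹ * (1 + t * v)⁻¹ ^ n) Filter.atTop (nhds 0) := by
    have h1 : Filter.Tendsto (fun t => 1 + t * v) Filter.atTop Filter.atTop :=
      Filter.tendsto_atTop_add_const_left _ _ (Filter.tendsto_id.atTop_mul_const hv)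
    have h2 := (h1.inv_tendsto_atTop.pow n).const_mul (-(v * n)⁻¹)
    simpa [hn] using h2
  rw [← ofReal_integral_eq_lintegral_ofReal (integrableOn_Ioi_deriv_of_nonneg' hd hpos hlim)
    ((ae_restrict_mem measurableSet_Ioi).mono hpos),
    integral_Ioi_of_hasDerivAt_of_nonneg' hd hpos hlim]
  simp

/-- By Tonelli the `t`-integral can be taken last; its integrand is the product of `n + 1` Laplace
transforms `(1 + t v)⁻¹`. -/
theorem lintegral_inv_sum_sq_norm {v : ℝ} (hv : 0 < v) {ι : Type*} [Fintype ι] {n : ℕ}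
    (hn : n ≠ 0) (hι : Fintype.card ι = n + 1) :
    ∫⁻ z : ι → ℂ, (ENNReal.ofReal (∑ i, ‖z i‖ ^ 2))⁻¹ ∂(Measure.pi fun _ => complexGaussian v)
      = ENNReal.ofReal (v * n)⁻¹ := by
  have h1 : ∀ z : ι → ℂ, (ENNReal.ofReal (∑ i, ‖z i‖ ^ 2))⁻¹ =
      ∫⁻ t in Set.Ioi (0 : ℝ), ENNReal.ofReal (Real.exp (-t * ∑ i, ‖z i‖ ^ 2)) :=
    fun z => (lintegral_exp_neg_mul_Ioi _ (by positivity)).symm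
  simp_rw [h1]
  rw [lintegral_lintegral_swap (by fun_prop), ← lintegral_inv_one_add_mul_pow_Ioi hv hn]
  refine setLIntegral_congr_fun measurableSet_Ioi fun t ht => ?_
  have ht' : (0 : ℝ) < t := ht
  rw [← ofReal_integral_eq_lintegral_ofReal]
  · congr 1
    simp_rw [Finset.mul_sum, Real.exp_sum]
    rw [integral_fintype_prod_eq_prod (fun _ z => Real.exp (-t * ‖z‖ ^ 2))]
    simp_rw [integral_exp_neg_mul_sq_norm_complexGaussian hv ht'.le]
    rw [Finset.prod_const, Finset.card_univ, hι]
  · refine Integrable.of_bound (C := 1) (Measurable.aestronglyMeasurable (by fun_prop))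
      (.of_forall fun z => ?_)
    rw [Real.norm_eq_abs, Real.abs_exp]
    refine Real.exp_le_one_iff.mpr ?_
    have : 0 ≤ ∑ i, ‖z i‖ ^ 2 := by positivity
    nlinarith
  · exact .of_forall fun z => by positivity

/-- The expectation of `1 / ‖P a‖²` for a vector `a` with `CN(0, v)` entries and the orthogonal
projection `P` onto a subspace of dimension `n + 1`. -/
theorem lintegral_inv_sq_norm_starProjection {v : ℝ} (hv : 0 < v) {ρ : Type*} [Fintype ρ]
    (U : Submodule ℂ (EuclideanSpace ℂ ρ)) {n : ℕ} (hn : n ≠ 0)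
    (hU : Module.finrank ℂ U = n + 1) :
    ∫⁻ a : ρ → ℂ, (ENNReal.ofReal (‖U.starProjection (WithLp.toLp 2 a)‖ ^ 2))⁻¹
        ∂(Measure.pi fun _ => complexGaussian v)
      = ENNReal.ofReal (v * n)⁻¹ := by
  classical
  let b := stdOrthonormalBasis ℂ U
  -- `C` computes the coordinates of the projection in an orthonormal basis of `U`. Since `C * Cᴴ =
  -- 1`, these coordinates are again independent `CN(0, v)`.
  let C : Matrix (Fin (Module.finrank ℂ U)) ρ ℂ := Matrix.of fun j r => star ((b j : EuclideanSpace ℂ ρ) r)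
  have hCb : ∀ a j, (C *ᵥ a) j = inner ℂ (b j : EuclideanSpace ℂ ρ) (WithLp.toLp 2 a) := by
    intro a j
    simp [C, Matrix.mulVec, dotProduct, PiLp.inner_apply, mul_comm]
  have hCC : C * Cᴴ = 1 := by
    ext j l
    have h := orthonormal_iff_ite.1 b.orthonormal j l
    rw [Submodule.coe_inner, PiLp.inner_apply] at h
    rw [Matrix.mul_apply, Matrix.one_apply, ← h]
    exact Finset.sum_congr rfl fun r _ => by simp [C, mul_comm]
  have hmap := map_mulVec_pi_complexGaussian (v := fun _ : ρ => v)
    (w := fun _ : Fin (Module.finrank ℂ U) => v) (fun _ => hv.le) (fun _ => hv.le) C (by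
      rw [← Matrix.smul_one_eq_diagonal, ← Matrix.smul_one_eq_diagonal, Matrix.mul_smul,
        Matrix.smul_mul, Matrix.mul_one, hCC])
  rw [← lintegral_inv_sum_sq_norm hv hn (ι := Fin (Module.finrank ℂ U)) (by simpa using hU),
    ← hmap, lintegral_map (by fun_prop) (by fun_prop)]
  refine lintegral_congr fun a => ?_
  congr 2
  rw [Submodule.starProjection_apply, Submodule.norm_coe, ← b.sum_sq_norm_inner_right]
  refine Finset.sum_congr rfl fun j _ => ?_
  rw [hCb, Submodule.inner_orthogonalProjectionOnto_eq_of_mem_left]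

/-- On `W` the projection to `Wᗮ` vanishes and its inverse squared norm is infinite, whereas the
mean of that inverse is finite. Codimension 2 is what the finite mean requires, and `K + 1 ≤ R`
supplies it. -/
theorem ae_notMem_submodule {v : ℝ} (hv : 0 < v) {ρ : Type*} [Fintype ρ]
    (W : Submodule ℂ (EuclideanSpace ℂ ρ)) (hW : Module.finrank ℂ W + 2 ≤ Fintype.card ρ) :
    ∀ᵐ a : ρ → ℂ ∂(Measure.pi fun _ => complexGaussian v), WithLp.toLp 2 a ∉ W := by
  have h1 := W.finrank_add_finrank_orthogonal
  rw [finrank_euclideanSpace] at h1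
  obtain ⟨n, hn⟩ : ∃ n, Module.finrank ℂ Wᗮ = (n + 1) + 1 :=
    ⟨Module.finrank ℂ Wᗮ - 2, by omega⟩
  have h2 := lintegral_inv_sq_norm_starProjection hv Wᗮ (Nat.succ_ne_zero n) hn
  have h3 := ae_lt_top' (μ := Measure.pi fun _ : ρ => complexGaussian v)
    (f := fun a => (ENNReal.ofReal (‖Wᗮ.starProjection (WithLp.toLp 2 a)‖ ^ 2))⁻¹) (by fun_prop)
    (by rw [h2]; exact ENNReal.ofReal_ne_top)
  filter_upwards [h3] with a ha hmem
  rw [(Submodule.starProjection_apply_eq_zero_iff _).2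
    (Submodule.le_orthogonal_orthogonal W hmem)] at ha
  simp at ha

/-! ### Geometry of the zero-forcing detector. -/

section InnerProductSpace

variable {E : Type*} [NormedAddCommGroup E] [InnerProductSpace ℂ E] [FiniteDimensional ℂ E]

/-- The dual vector of `a k` in the span of a family `a` has norm inverse to the distance of `a k`
to the span of the other vectors. -/
theorem sq_norm_dual_vector {ι : Type*} [Fintype ι] (a : ι → E) (k : ι) (q : E)
    (hq : q ∈ Submodule.span ℂ (Set.range a)) (hk : inner ℂ q (a k) = 1)
    (hi : ∀ i, i ≠ k → inner ℂ q (a i) = 0) :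
    ‖q‖ ^ 2 = (‖(Submodule.span ℂ (a '' {i | i ≠ k}))ᗮ.starProjection (a k)‖ ^ 2)⁻¹ := by
  set W := Submodule.span ℂ (a '' {i | i ≠ k}) with hW
  have hqW : q ∈ Wᗮ := by
    rw [Submodule.mem_orthogonal']
    intro u hu
    refine Submodule.span_induction ?_ (by simp) ?_ ?_ hu
    · rintro _ ⟨i, hik, rfl⟩
      exact hi i hik
    · intro x y _ _ hx hy
      rw [inner_add_right, hx, hy, add_zero]
    · intro c x _ hx
      rw [inner_smul_right, hx, mul_zero]
  obtain ⟨c, hc⟩ := (Submodule.mem_span_range_iff_exists_fun ℂ).1 hq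
  -- Projecting `q = ∑ c i • a i` to `Wᗮ` fixes `q` and kills every term but the `k`-th. The
  -- normalisation against `a k` then forces `|c k| = ‖p‖⁻²`, where `p` is the projection of `a k`.
  have hP : q = c k • Wᗮ.starProjection (a k) := by
    rw [← Submodule.starProjection_eq_self_iff.2 hqW]
    conv_lhs => rw [← hc]
    rw [map_sum, Finset.sum_eq_single k]
    · rw [map_smul]
    · intro i _ hik
      rw [map_smul, (Submodule.starProjection_apply_eq_zero_iff _).2, smul_zero]
      exact Submodule.le_orthogonal_orthogonal W (Submodule.subset_span ⟨i, hik, rfl⟩)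
    · simp
  set p := Wᗮ.starProjection (a k) with hp
  have h1 : inner ℂ p (a k) = ((‖p‖ ^ 2 : ℝ) : ℂ) := by
    have h : Wᗮ.starProjection p = p := by
      rw [hp]
      exact Submodule.starProjection_eq_self_iff.2 (Submodule.starProjection_apply_mem _ _)
    rw [← h, Submodule.inner_starProjection_left_eq_right, ← hp, h, inner_self_eq_norm_sq_to_K]
    norm_cast
  rw [hP, inner_smul_left, h1] at hk
  have h2 := congrArg norm hk
  rw [norm_mul, RCLike.norm_conj, Complex.norm_real, norm_pow, norm_norm, norm_one] at h2
  rw [hP, norm_smul, mul_pow]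
  have h3 : ‖p‖ ^ 2 ≠ 0 := by
    intro h
    rw [h, mul_zero] at h2
    exact zero_ne_one h2
  have h4 : ‖c k‖ = (‖p‖ ^ 2)⁻¹ := eq_inv_of_mul_eq_one_left h2
  rw [h4]
  field_simp

end InnerProductSpace

open scoped ComplexOrder in
theorem isUnit_det_conjTranspose_mul_self {A : Matrix (Fin R) (Fin K) ℂ}
    (hA : LinearIndependent ℂ A.col) : IsUnit (Aᴴ * A).det := by
  have h := Matrix.PosDef.conjTranspose_mul_self A (Matrix.mulVec_injective_iff.2 hA)
  exact h.det_pos.ne'.isUnit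

theorem star_zfDetector_dotProduct {A : Matrix (Fin R) (Fin K) ℂ} (hA : IsUnit (Aᴴ * A).det)
    (k i : Fin K) :
    star ((zfDetector A).col k) ⬝ᵥ A.col i = if k = i then 1 else 0 := by
  have h : (zfDetector A)ᴴ * A = 1 := by
    rw [zfDetector, Matrix.conjTranspose_mul, Matrix.conjTranspose_nonsing_inv,
      Matrix.conjTranspose_mul, Matrix.conjTranspose_conjTranspose, Matrix.mul_assoc,
      Matrix.nonsing_inv_mul _ hA]
  rw [← Matrix.one_apply, ← h]
  rfl

/-- The noise amplification `q_k^H q_k` of the zero-forcing detector. -/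
noncomputable def zfNoiseGain (A : Matrix (Fin R) (Fin K) ℂ) (k : Fin K) : ℝ :=
  ‖star ((zfDetector A).col k) ⬝ᵥ (zfDetector A).col k‖

theorem zfNoiseGain_eq_sq_norm (A : Matrix (Fin R) (Fin K) ℂ) (k : Fin K) :
    zfNoiseGain A k = ‖WithLp.toLp 2 ((zfDetector A).col k)‖ ^ 2 := by
  have h : star ((zfDetector A).col k) ⬝ᵥ (zfDetector A).col k
      = inner ℂ (WithLp.toLp 2 ((zfDetector A).col k)) (WithLp.toLp 2 ((zfDetector A).col k)) := by
    rw [EuclideanSpace.inner_toLp_toLp, dotProduct_comm]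
  rw [zfNoiseGain, h, inner_self_eq_norm_sq_to_K, norm_pow, RCLike.norm_ofReal, abs_norm]

/-- The columns of the detector lie in the column span of `A`, and `Qᴴ * A = 1`; hence `q_k` is the
dual vector of `sq_norm_dual_vector`. -/
theorem zfNoiseGain_eq_inv_sq_norm {A : Matrix (Fin R) (Fin K) ℂ} (hA : LinearIndependent ℂ A.col)
    (k : Fin K) :
    zfNoiseGain A k = (‖(Submodule.span ℂ ((fun i => WithLp.toLp 2 (A.col i)) ''
      {i | i ≠ k}))ᗮ.starProjection (WithLp.toLp 2 (A.col k))‖ ^ 2)⁻¹ := by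
  have hdet := isUnit_det_conjTranspose_mul_self hA
  have hinner : ∀ i, inner ℂ (WithLp.toLp 2 ((zfDetector A).col k)) (WithLp.toLp 2 (A.col i))
      = if k = i then 1 else 0 := by
    intro i
    rw [EuclideanSpace.inner_toLp_toLp, dotProduct_comm, star_zfDetector_dotProduct hdet]
  rw [zfNoiseGain_eq_sq_norm]
  refine sq_norm_dual_vector (fun i => WithLp.toLp 2 (A.col i)) k _ ?_ ?_ ?_
  · rw [Submodule.mem_span_range_iff_exists_fun]
    refine ⟨fun i => ((Aᴴ * A)⁻¹) i k, ?_⟩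
    ext r
    simp [zfDetector, Matrix.mul_apply, mul_comm]
  · simp [hinner]
  · intro i hi
    simp [hinner, hi.symm]

theorem zfNoiseGain_pos {A : Matrix (Fin R) (Fin K) ℂ} (hA : LinearIndependent ℂ A.col)
    (k : Fin K) : 0 < zfNoiseGain A k := by
  rw [zfNoiseGain_eq_sq_norm]
  have h := star_zfDetector_dotProduct (isUnit_det_conjTranspose_mul_self hA) k k
  have h0 : (zfDetector A).col k ≠ 0 := by
    intro h0
    simp [h0] at h
  have : WithLp.toLp 2 ((zfDetector A).col k) ≠ 0 := by simpa using h0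
  positivity

/-- Projections do not increase norms. This bounds the SINR from above and serves the integrability
of the rate. -/
theorem inv_zfNoiseGain_le {A : Matrix (Fin R) (Fin K) ℂ} (hA : LinearIndependent ℂ A.col)
    (k : Fin K) : (zfNoiseGain A k)⁻¹ ≤ ∑ r, ‖A r k‖ ^ 2 := by
  rw [zfNoiseGain_eq_inv_sq_norm hA, inv_inv]
  calc _ ≤ ‖WithLp.toLp 2 (A.col k)‖ ^ 2 := by
        gcongr
        exact Submodule.norm_starProjection_apply_le _ _
    _ = _ := by rw [EuclideanSpace.norm_sq_eq]; rfl

theorem measurable_zfNoiseGain {α : Type*} [MeasurableSpace α]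
    {A : α → Matrix (Fin R) (Fin K) ℂ} (hA : ∀ r i, Measurable fun x => A x r i) (k : Fin K) :
    Measurable fun x => zfNoiseGain (A x) k := by
  have h1 : Measurable fun a : Fin R → Fin K → ℂ => zfNoiseGain (Matrix.of a) k := by
    have hc : Continuous fun a : Fin R → Fin K → ℂ => Matrix.of a := continuous_id
    have hg : Continuous fun a : Fin R → Fin K → ℂ => (Matrix.of a)ᴴ * Matrix.of a :=
      hc.matrix_conjTranspose.matrix_mul hc
    have hinv : ∀ i j, Measurable fun a : Fin R → Fin K → ℂ =>
        ((Matrix.of a)ᴴ * Matrix.of a)⁻¹ i j := by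
      intro i j
      simp only [Matrix.inv_def, Ring.inverse_eq_inv', Matrix.smul_apply, smul_eq_mul]
      exact hg.matrix_det.measurable.inv.mul (hg.matrix_adjugate.matrix_elem i j).measurable
    have hq : ∀ r, Measurable fun a : Fin R → Fin K → ℂ => zfDetector (Matrix.of a) r k := by
      intro r
      simp only [zfDetector, Matrix.mul_apply (M := Matrix.of _)]
      exact Finset.measurable_sum _ fun i _ => (hc.matrix_elem r i).measurable.mul (hinv i k)
    unfold zfNoiseGain
    simp only [dotProduct, Pi.star_apply, Matrix.col_apply]
    exact (Finset.measurable_sum _ fun r _ => (continuous_star.measurable.comp (hq r)).mul (hq r)).norm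
  exact h1.comp (measurable_pi_lambda _ fun r => measurable_pi_lambda _ fun i => hA r i)

/-! ### Gaussian columns: full rank and mean noise amplification. -/

/-- Induction on the number of columns: with the others fixed and independent, a new Gaussian column
almost surely avoids their span. -/
theorem ae_linearIndependent_pi_complexGaussian (hR : K + 1 ≤ R) {w : Fin K → ℝ}
    (hw : ∀ i, 0 < w i) :
    ∀ᵐ a : Fin K → Fin R → ℂ ∂(Measure.pi fun i => Measure.pi fun _ => complexGaussian (w i)),
      LinearIndependent ℂ a := by
  induction K with
  | zero => exact .of_forall fun a => linearIndependent_empty_type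
  | succ n ih =>
    have hmp := measurePreserving_piFinSuccAbove
      (fun i : Fin (n + 1) => Measure.pi fun _ : Fin R => complexGaussian (w i)) 0
    have hms : MeasurableSet {z : (Fin R → ℂ) × (Fin n → Fin R → ℂ) |
        LinearIndependent ℂ (Fin.cons z.1 z.2 : Fin (n + 1) → Fin R → ℂ)} := by
      refine (isOpen_setOfPred_linearIndependent (𝕜 := ℂ)).preimage ?_ |>.measurableSet
      exact continuous_pi (Fin.cases continuous_fst fun j => (continuous_apply j).comp continuous_snd)
    have h : ∀ᵐ z ∂((Measure.pi fun _ : Fin R => complexGaussian (w 0)).prod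
        (Measure.pi fun j : Fin n => Measure.pi fun _ : Fin R =>
          complexGaussian (w ((0 : Fin (n + 1)).succAbove j)))),
        LinearIndependent ℂ (Fin.cons z.1 z.2 : Fin (n + 1) → Fin R → ℂ) := by
      -- The order of the quantifiers is exchanged so that the span is fixed before the new column
      -- is drawn.
      rw [Measure.ae_prod_iff_ae_ae hms, Measure.ae_ae_comm hms]
      filter_upwards [ih (by omega) fun j => hw ((0 : Fin (n + 1)).succAbove j)] with y hy
      have hy' : LinearIndependent ℂ fun i => WithLp.toLp 2 (y i) :=
        hy.map' (WithLp.linearEquiv 2 ℂ (Fin R → ℂ)).symm.toLinearMap (LinearEquiv.ker _)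
      filter_upwards [ae_notMem_submodule (hw 0) (Submodule.span ℂ
        (Set.range fun i => WithLp.toLp 2 (y i))) (by
          rw [finrank_span_eq_card hy', Fintype.card_fin, Fintype.card_fin]; omega)] with x hx
      refine linearIndependent_finCons.2 ⟨hy, fun hmem => hx ?_⟩
      have := Submodule.mem_map_of_mem
        (f := (WithLp.linearEquiv 2 ℂ (Fin R → ℂ)).symm.toLinearMap) hmem
      rwa [Submodule.map_span, ← Set.range_comp] at this
    filter_upwards [hmp.quasiMeasurePreserving.ae h] with a ha
    have h2 : (Fin.cons (MeasurableEquiv.piFinSuccAbove (fun _ => Fin R → ℂ) 0 a).1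
        (MeasurableEquiv.piFinSuccAbove (fun _ => Fin R → ℂ) 0 a).2 :
          Fin (n + 1) → Fin R → ℂ) = a := Fin.cons_self_tail a
    rwa [h2] at ha

/-- The mean noise amplification of the zero-forcing detector for independent complex Gaussian
columns. -/
theorem lintegral_zfNoiseGain (hR : K + 1 ≤ R) {w : Fin K → ℝ} (hw : ∀ i, 0 < w i) (k : Fin K) :
    ∫⁻ a : Fin K → Fin R → ℂ, ENNReal.ofReal (zfNoiseGain (Matrix.of fun r i => a i r) k)
        ∂(Measure.pi fun i => Measure.pi fun _ => complexGaussian (w i))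
      = ENNReal.ofReal (w k * ((R : ℝ) - K))⁻¹ := by
  obtain ⟨n, rfl⟩ : ∃ n, K = n + 1 := ⟨K - 1, by have := k.pos; omega⟩
  obtain ⟨l, rfl⟩ : ∃ l, R = (n + 1) + (l + 1) := ⟨R - (n + 1) - 1, by omega⟩
  set ρ := Fin (n + 1 + (l + 1))
  have hmp := (measurePreserving_piFinSuccAbove
      (fun i : Fin (n + 1) => Measure.pi fun _ : ρ => complexGaussian (w i)) k).symm
  have hae := hmp.quasiMeasurePreserving.ae (ae_linearIndependent_pi_complexGaussian hR hw)
  have hmeas : Measurable fun a : Fin (n + 1) → ρ → ℂ =>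
      ENNReal.ofReal (zfNoiseGain (Matrix.of fun r i => a i r) k) :=
    (measurable_zfNoiseGain (fun r i => by simp only [Matrix.of_apply]; fun_prop) k).ennreal_ofReal
  have hms : MeasurableSet {z : (ρ → ℂ) × (Fin n → ρ → ℂ) | LinearIndependent ℂ
      ((MeasurableEquiv.piFinSuccAbove (fun _ => ρ → ℂ) k).symm z)} :=
    (MeasurableEquiv.measurable _)
      (isOpen_setOfPred_linearIndependent (𝕜 := ℂ)).measurableSet
  rw [Measure.ae_prod_iff_ae_ae hms, Measure.ae_ae_comm hms] at hae
  rw [← hmp.lintegral_comp hmeas]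
  refine (lintegral_prod_symm _ (hmeas.comp (MeasurableEquiv.measurable _)).aemeasurable).trans ?_
  -- Given almost any choice `y` of the other columns, the mean over column `k` depends on `y` only
  -- through the dimension of the orthogonal complement, hence is constant.
  have hconst : ∀ᵐ y ∂(Measure.pi fun j : Fin n => Measure.pi fun _ : ρ =>
      complexGaussian (w (k.succAbove j))),
      ∫⁻ x, ENNReal.ofReal (zfNoiseGain (Matrix.of fun r i =>
        (MeasurableEquiv.piFinSuccAbove (fun _ => ρ → ℂ) k).symm (x, y) i r) k)
        ∂(Measure.pi fun _ : ρ => complexGaussian (w k))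
      = ENNReal.ofReal (w k * ((n + 1 + (l + 1) : ℕ) - ((n + 1 : ℕ) : ℝ)))⁻¹ := by
    filter_upwards [hae, ae_linearIndependent_pi_complexGaussian (by omega : n + 1 ≤ n + 1 + (l + 1))
      fun j => hw (k.succAbove j)] with y hy hy1
    have hy2 : LinearIndependent ℂ fun i => WithLp.toLp 2 (y i) :=
      hy1.map' (WithLp.linearEquiv 2 ℂ (ρ → ℂ)).symm.toLinearMap (LinearEquiv.ker _)
    set W := Submodule.span ℂ (Set.range fun i => WithLp.toLp 2 (y i)) with hW
    have hWn : Module.finrank ℂ W = n := by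
      rw [hW, finrank_span_eq_card hy2, Fintype.card_fin]
    have hWo := W.finrank_add_finrank_orthogonal
    rw [finrank_euclideanSpace, hWn, Fintype.card_fin] at hWo
    have hcast : ((n + 1 + (l + 1) : ℕ) - ((n + 1 : ℕ) : ℝ)) = ((l + 1 : ℕ) : ℝ) := by
      push_cast
      ring
    -- The dimension is `R - K + 1`, one more than the factor `l + 1 = R - K` in the mean.
    have hWo' : Module.finrank ℂ Wᗮ = l + 1 + 1 := by omega
    rw [hcast, ← lintegral_inv_sq_norm_starProjection (hw k) Wᗮ (Nat.succ_ne_zero l) hWo']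
    refine lintegral_congr_ae ?_
    filter_upwards [hy] with x hx
    set a := (MeasurableEquiv.piFinSuccAbove (fun _ => ρ → ℂ) k).symm (x, y) with ha
    have hak : a k = x := Fin.insertNth_apply_same (α := fun _ => ρ → ℂ) k x y
    have haj : ∀ j, a (k.succAbove j) = y j :=
      Fin.insertNth_apply_succAbove (α := fun _ => ρ → ℂ) k x y
    have hcol : (Matrix.of fun r i => a i r).col = a := rfl
    have hpos := zfNoiseGain_pos (A := Matrix.of fun r i => a i r) hx k
    have hWa : Submodule.span ℂ ((fun i => WithLp.toLp 2 (a i)) '' {i | i ≠ k}) = W := by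
      have : {i | i ≠ k} = Set.range k.succAbove := by
        rw [Fin.range_succAbove]; rfl
      rw [this, ← Set.range_comp, hW]
      congr 2
      ext1 j
      simp [haj]
    have heq := zfNoiseGain_eq_inv_sq_norm (A := Matrix.of fun r i => a i r) hx k
    rw [hcol, hWa, hak] at heq
    rw [heq] at hpos ⊢
    rw [ENNReal.ofReal_inv_of_pos (inv_pos.1 hpos)]
  refine (lintegral_congr_ae hconst).trans ?_
  simp

/-! ### The two estimators and their conditional law. -/

theorem map_curry_pi {ι κ E : Type*} [Fintype ι] [Fintype κ] [MeasurableSpace E]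
    (ν : ι → κ → Measure E) [∀ i r, IsProbabilityMeasure (ν i r)] :
    (Measure.pi fun x : ι × κ => ν x.1 x.2).map (fun a i r => a (i, r))
      = Measure.pi fun i => Measure.pi (ν i) := by
  let e := MeasurableEquiv.curry ι κ E
  have h : (Measure.pi fun i => Measure.pi (ν i)).map e.symm
      = Measure.pi fun x : ι × κ => ν x.1 x.2 := by
    refine (Measure.pi_eq fun s hs => ?_).symm
    rw [e.symm.map_apply]
    have : e.symm ⁻¹' Set.univ.pi s
        = Set.univ.pi fun i => Set.univ.pi fun r => s (i, r) := by
      ext a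
      simp [e, Set.mem_pi]
    rw [this, Measure.pi_pi, Fintype.prod_prod_type]
    simp_rw [Measure.pi_pi]
  rw [← h, Measure.map_map (by fun_prop) e.symm.measurable]
  exact Measure.map_id

theorem Params.p_pos (P : Params K) (k : Fin K) : 0 < P.p k := mul_pos (P.δ_pos k) (P.PI_pos k)

theorem Params.D_pos_of_isometry {P : Params K} {G : Matrix (Fin P.D) (Fin M) ℂ}
    (hG : Gᴴ * G = 1) (m : Fin M) : 0 < P.D := by
  by_contra h
  have h0 : P.D = 0 := by omega
  have : IsEmpty (Fin P.D) := by rw [h0]; infer_instance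
  have h1 := congrFun (congrFun hG m) m
  simp [Matrix.mul_apply] at h1

theorem Params.errVar_pos (P : Params K) (hD : 0 < P.D) (method : Method) (k : Fin K) :
    0 < P.errVar method k := by
  have h1 := P.σ2_pos
  have h2 := P.pce_pos
  have h3 := P.δ_pos k
  have h4 := P.β_pos k
  have h5 : (0 : ℝ) < P.D := by exact_mod_cast hD
  cases method <;> simp only [Params.errVar] <;> positivity

/-- The least squares estimate is the channel plus the filtered noise. -/
theorem lsEstimate_pilotSignal_apply (P : Params K) {G : Matrix (Fin P.D) (Fin M) ℂ}
    (hG : Gᴴ * G = 1) (k : Fin K) (H : Matrix (Fin R) (Fin M) ℂ)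
    (N : Matrix (Fin R) (Fin P.D) ℂ) (r : Fin R) (m : Fin M) :
    lsEstimate P G k (pilotSignal P G k H N) r m = H r m +
      ∑ d, (((Real.sqrt (P.δ k) : ℝ) : ℂ)⁻¹ * ((Real.sqrt (P.D * P.pce) : ℝ) : ℂ)⁻¹ * star (G d m))
        * N r d := by
  have hD : (0 : ℝ) < P.D := by exact_mod_cast Params.D_pos_of_isometry hG m
  have hx : ((Real.sqrt (P.D * P.pce) : ℝ) : ℂ) ≠ 0 :=
    Complex.ofReal_ne_zero.2 (Real.sqrt_pos.2 (mul_pos hD P.pce_pos)).ne'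
  have hδ : ((Real.sqrt (P.δ k) : ℝ) : ℂ) ≠ 0 :=
    Complex.ofReal_ne_zero.2 (Real.sqrt_pos.2 (P.δ_pos k)).ne'
  let J : Matrix (Fin M) (Fin M) ℂ :=
    Matrix.diagonal fun _ => ((Real.sqrt (P.D * P.pce) : ℝ) : ℂ)⁻¹
  have hB : P.sqrtB M * J = 1 := by
    rw [Params.sqrtB, Matrix.diagonal_mul_diagonal, ← Matrix.diagonal_one]
    exact congrArg _ (funext fun _ => mul_inv_cancel₀ hx)
  have hBinv := Matrix.inv_eq_right_inv hB
  have hBt : (P.sqrtB M)ᵀ = P.sqrtB M := Matrix.diagonal_transpose _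
  have hGt : Gᵀ * G.map star = 1 := by
    have h := congrArg Matrix.transpose hG
    rwa [Matrix.transpose_mul, Matrix.transpose_one] at h
  have hmul : H * (G * P.sqrtB M)ᵀ * G.map star *
      J = H := by
    rw [Matrix.transpose_mul, hBt, ← Matrix.mul_assoc H, Matrix.mul_assoc _ Gᵀ, hGt, Matrix.mul_one,
      Matrix.mul_assoc, hB, Matrix.mul_one]
  rw [lsEstimate, pilotSignal, hBinv, Matrix.add_mul, Matrix.add_mul, Matrix.smul_mul,
    Matrix.smul_mul, hmul, smul_add, smul_smul, inv_mul_cancel₀ hδ, one_smul]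
  simp only [J, Matrix.add_apply, Matrix.smul_apply, smul_eq_mul, Matrix.mul_diagonal,
    Matrix.mul_apply (M := N), Matrix.map_apply, Finset.sum_mul, Finset.mul_sum]
  congr 1
  exact Finset.sum_congr rfl fun d _ => by ring

/-- Both estimates add to the channel coefficients of the antenna `m` a linear combination of
independent complex Gaussian variables, whose variance is that of the estimation error. -/
theorem IsEstimate.exists_eq_add_sum {P : Params K} {G : Matrix (Fin P.D) (Fin M) ℂ}
    (hG : Gᴴ * G = 1) {hf : Fin M → Fin K → Ω → ℂ} {hb : Fin K → Fin R → Ω → ℂ}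
    {Hhat : Fin K → Ω → Matrix (Fin R) (Fin M) ℂ} {method : Method}
    (hest : IsEstimate P G hf hb Hhat μ method) (m : Fin M) :
    ∃ (D : ℕ) (E : Fin K → Fin R → Fin D → Ω → ℂ) (vE : Fin K → ℝ) (c : Fin K → Fin D → ℂ),
      IsIndepCN
        (Sum.elim (fun x : Fin M × Fin K => hf x.1 x.2)
          (Sum.elim (fun x : Fin K × Fin R => hb x.1 x.2)
            (fun x : Fin K × Fin R × Fin D => E x.1 x.2.1 x.2.2)))
        (Sum.elim (fun x => P.β x.2) (Sum.elim (fun x => P.β x.1) (fun x => vE x.1))) μ ∧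
      (∀ i, 0 < vE i) ∧ (∀ i, vE i * ∑ d, ‖c i d‖ ^ 2 = P.errVar method i) ∧
      ∀ i r ω, Hhat i ω r m = hf m i ω * hb i r ω + ∑ d, c i d * E i r d ω := by
  have hD := Params.D_pos_of_isometry hG m
  cases method with
  | LS =>
    obtain ⟨N, hN, hH⟩ := hest
    -- The coefficients are those of the filtered noise; their squared norms sum to `1 / (δ i * D *
    -- pce)` because column `m` of `G` is a unit vector.
    refine ⟨P.D, N, fun _ => P.σ2, fun i d => ((Real.sqrt (P.δ i) : ℝ) : ℂ)⁻¹ *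
      ((Real.sqrt (P.D * P.pce) : ℝ) : ℂ)⁻¹ * star (G d m), hN, fun _ => P.σ2_pos, fun i => ?_,
      fun i r ω => ?_⟩
    · have hG1 : ∑ d, ‖G d m‖ ^ 2 = 1 := by
        have h := congrFun (congrFun hG m) m
        rw [Matrix.mul_apply, Matrix.one_apply_eq] at h
        have h2 : ∀ d, Gᴴ m d * G d m = ((‖G d m‖ ^ 2 : ℝ) : ℂ) := by
          intro d
          rw [Matrix.conjTranspose_apply, Complex.star_def, Complex.conj_mul']
          push_cast
          rfl
        simp_rw [h2, ← Complex.ofReal_sum] at h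
        exact_mod_cast h
      have h1 := P.pce_pos
      have h2 := P.δ_pos i
      simp only [norm_mul, norm_inv, norm_star, Complex.norm_real, mul_pow, inv_pow,
        Real.norm_eq_abs, sq_abs]
      rw [← Finset.mul_sum, hG1, Real.sq_sqrt h2.le, Real.sq_sqrt (by positivity), Params.errVar]
      have h5 : (0 : ℝ) < P.D := by exact_mod_cast hD
      field_simp
    · rw [hH, lsEstimate_pilotSignal_apply P hG, backscatter, Matrix.vecMulVec_apply]
      simp only [Matrix.of_apply]
      ring
  | MMSE =>
    obtain ⟨E, hE, hH⟩ := hest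
    -- The error is already additive; the coefficients merely select its column `m`.
    refine ⟨M, E, fun i => P.errVar .MMSE i, fun _ d => if d = m then 1 else 0, hE,
      fun i => P.errVar_pos hD _ i, fun i => ?_, fun i r ω => ?_⟩
    · have : ∀ d : Fin M, ‖(if d = m then 1 else 0 : ℂ)‖ ^ 2 = if d = m then 1 else 0 := by
        intro d
        split_ifs <;> simp
      simp [this]
    · rw [hH, Matrix.add_apply, backscatter, Matrix.vecMulVec_apply]
      simp
      ring

/-- Tonelli for two independent blocks: `Z` is integrated against its law while `X` stays a random
variable on `Ω`. It plays the role of conditioning on `X`. -/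
theorem IsIndepCN.lintegral_sum_elim [IsProbabilityMeasure μ] {α ι : Type*} [Fintype α] [Fintype ι]
    {X : α → Ω → ℂ} {Z : ι → Ω → ℂ} {u : α → ℝ} {v : ι → ℝ}
    (h : IsIndepCN (Sum.elim X Z) (Sum.elim u v) μ)
    {F : (α → ℂ) × (ι → ℂ) → ENNReal} (hF : Measurable F) :
    ∫⁻ ω, F (fun i => X i ω, fun i => Z i ω) ∂μ
      = ∫⁻ ω, ∫⁻ z, F (fun i => X i ω, z) ∂(Measure.pi fun i => complexGaussian (v i)) ∂μ := by
  have hX : ∀ i, AEMeasurable (X i) μ := fun i => (h.law (.inl i)).aemeasurable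
  have hZ : ∀ i, AEMeasurable (Z i) μ := fun i => (h.law (.inr i)).aemeasurable
  have hm := (iIndepFun_iff_map_fun_eq_pi_map fun i => (h.law i).aemeasurable).1 h.indep
  simp_rw [fun i => (h.law i).map_eq] at hm
  have hmp := measurePreserving_sumPiEquivProdPi
    (fun i : α ⊕ ι => complexGaussian (Sum.elim u v i))
  have hjoint : μ.map (fun ω => (fun i => X i ω, fun i => Z i ω))
      = (Measure.pi fun i => complexGaussian (u i)).prod
        (Measure.pi fun i => complexGaussian (v i)) := by
    refine Eq.trans ?_ hmp.map_eq
    rw [← hm, AEMeasurable.map_map_of_aemeasurable hmp.measurable.aemeasurable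
      (aemeasurable_pi_lambda _ fun i => (h.law i).aemeasurable)]
    rfl
  have hXm : AEMeasurable (fun ω => (fun i => X i ω)) μ := aemeasurable_pi_lambda _ hX
  have hZm : AEMeasurable (fun ω => (fun i => Z i ω)) μ := aemeasurable_pi_lambda _ hZ
  have hXlaw : μ.map (fun ω => (fun i => X i ω)) = Measure.pi fun i => complexGaussian (u i) := by
    have := congrArg (Measure.map Prod.fst) hjoint
    rw [AEMeasurable.map_map_of_aemeasurable measurable_fst.aemeasurable (hXm.prodMk hZm),
      Measure.map_fst_prod, measure_univ, one_smul] at this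
    exact this
  rw [← lintegral_map' (f := F) (g := fun ω => (fun i => X i ω, fun i => Z i ω))
    hF.aemeasurable (hXm.prodMk hZm), hjoint, lintegral_prod _ hF.aemeasurable, ← hXlaw,
    lintegral_map' (Measurable.aemeasurable hF.lintegral_prod_right') hXm]

/-- Conditionally on the forward coefficients `X`, the entries `(i, r)` of the estimate for a fixed
antenna are independent `CN(0, β_i |x_i|² + s_i)`. -/
theorem IsIndepCN.lintegral_estimate [IsProbabilityMeasure μ] {D : ℕ} {hf : Fin M → Fin K → Ω → ℂ}
    {hb : Fin K → Fin R → Ω → ℂ} {E : Fin K → Fin R → Fin D → Ω → ℂ} {β vE : Fin K → ℝ}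
    {c : Fin K → Fin D → ℂ}
    (h : IsIndepCN
        (Sum.elim (fun x : Fin M × Fin K => hf x.1 x.2)
          (Sum.elim (fun x : Fin K × Fin R => hb x.1 x.2)
            (fun x : Fin K × Fin R × Fin D => E x.1 x.2.1 x.2.2)))
        (Sum.elim (fun x => β x.2) (Sum.elim (fun x => β x.1) (fun x => vE x.1))) μ)
    (hβ : ∀ i, 0 < β i) (hvE : ∀ i, 0 < vE i) (m : Fin M)
    {F : (Fin K → ℂ) → (Fin K → Fin R → ℂ) → ENNReal} (hF : Measurable (Function.uncurry F)) :
    ∫⁻ ω, F (fun i => hf m i ω) (fun i r => hf m i ω * hb i r ω + ∑ d, c i d * E i r d ω) ∂μ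
      = ∫⁻ ω, ∫⁻ a, F (fun i => hf m i ω) a ∂(Measure.pi fun i => Measure.pi fun _ =>
          complexGaussian (β i * ‖hf m i ω‖ ^ 2 + vE i * ∑ d, ‖c i d‖ ^ 2)) ∂μ := by
  let A : (Fin K → ℂ) × ((Fin K × Fin R) ⊕ (Fin K × Fin R × Fin D) → ℂ) → Fin K → Fin R → ℂ :=
    fun q i r => q.1 i * q.2 (.inl (i, r)) + ∑ d, c i d * q.2 (.inr (i, r, d))
  have hA : Measurable A := by
    refine measurable_pi_lambda _ fun i => measurable_pi_lambda _ fun r => ?_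
    fun_prop
  have h1 := h.lintegral_sum_elim (F := fun q => F (fun i => q.1 (m, i))
    (A (fun i => q.1 (m, i), q.2))) (hF.comp (by fun_prop :
      Measurable fun q : (Fin M × Fin K → ℂ) × ((Fin K × Fin R) ⊕ (Fin K × Fin R × Fin D) → ℂ) =>
        ((fun i => q.1 (m, i)), A (fun i => q.1 (m, i), q.2))))
  refine h1.trans (lintegral_congr fun ω => ?_)
  set x : Fin K → ℂ := fun i => hf m i ω with hx
  -- For frozen forward coefficients the estimate is linear in the backward coefficients and errors.
  -- Distinct rows of `C` have disjoint supports, which makes the covariance diagonal.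
  let C : Matrix (Fin K × Fin R) ((Fin K × Fin R) ⊕ (Fin K × Fin R × Fin D)) ℂ :=
    Matrix.of fun y => Sum.elim (fun z => if z = y then x y.1 else 0)
      (fun z => if z.1 = y.1 ∧ z.2.1 = y.2 then c y.1 z.2.2 else 0)
  have hCA : ∀ z, A (x, z) = fun i r => (C *ᵥ z) (i, r) := by
    intro z
    ext i r
    simp [A, C, Matrix.mulVec, dotProduct, Fintype.sum_sum_type, Fintype.sum_prod_type, ite_and]
  have hmap := map_mulVec_pi_complexGaussian
    (v := Sum.elim (fun x : Fin K × Fin R => β x.1) (fun x : Fin K × Fin R × Fin D => vE x.1))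
    (w := fun y : Fin K × Fin R => β y.1 * ‖x y.1‖ ^ 2 + vE y.1 * ∑ d, ‖c y.1 d‖ ^ 2)
    (by rintro (z | z); exacts [(hβ _).le, (hvE _).le])
    (fun y => add_nonneg (mul_nonneg (hβ _).le (sq_nonneg _))
      (mul_nonneg (hvE _).le (Finset.sum_nonneg fun _ _ => sq_nonneg _))) C (by
      ext ⟨i, r⟩ ⟨j, s⟩
      rw [Matrix.mul_apply, Fintype.sum_sum_type, Fintype.sum_prod_type, Fintype.sum_prod_type,
        Matrix.diagonal_apply]
      simp only [Fintype.sum_prod_type, Matrix.mul_diagonal, Matrix.conjTranspose_apply, C,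
        Matrix.of_apply, Sum.elim_inl, Sum.elim_inr]
      by_cases hij : (i, r) = (j, s)
      · obtain ⟨rfl, rfl⟩ := Prod.mk.inj hij
        simp [ite_and]
        rw [← Complex.mul_conj', Finset.mul_sum]
        congr 1
        · ring
        · exact Finset.sum_congr rfl fun d _ => by rw [← Complex.mul_conj']; ring
      · rw [if_neg hij]
        rw [Prod.mk.injEq, not_and] at hij
        by_cases h1 : i = j
        · simp [ite_and, h1, hij h1]
        · simp [ite_and, h1])
  have hFx : Measurable (F x) := hF.comp measurable_prodMk_left
  change ∫⁻ z, F x (A (x, z)) ∂_ = _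
  simp_rw [hCA]
  rw [← map_curry_pi (fun (i : Fin K) (_ : Fin R) =>
    complexGaussian (β i * ‖x i‖ ^ 2 + vE i * ∑ d, ‖c i d‖ ^ 2)), ← hmap,
    Measure.map_map (by fun_prop) (by fun_prop),
    lintegral_map hFx (by fun_prop)]
  rfl

/-! ### Jensen's inequality for the rate. -/

/-- The tangent line bound of the convex function `x ↦ log (1 + 1 / x)`. -/
theorem log_one_add_inv_ge {x c : ℝ} (hx : 0 < x) (hc : 0 < c) :
    Real.log (1 + c⁻¹) - (x - c) / (c * (1 + c)) ≤ Real.log (1 + x⁻¹) := by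
  have h1 : Real.log ((1 + c⁻¹) / (1 + x⁻¹)) ≤ (1 + c⁻¹) / (1 + x⁻¹) - 1 :=
    Real.log_le_sub_one_of_pos (by positivity)
  rw [Real.log_div (by positivity) (by positivity)] at h1
  have h2 : (1 + c⁻¹) / (1 + x⁻¹) - 1 ≤ (x - c) / (c * (1 + c)) := by
    have h3 : (1 + c⁻¹) / (1 + x⁻¹) - 1 = (x - c) / (c * (1 + x)) := by
      field_simp
      ring
    rw [h3, div_le_div_iff₀ (by positivity) (by positivity)]
    -- After cross-multiplication the difference of the two sides is `c * (x - c)²`.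
    nlinarith [mul_nonneg hc.le (sq_nonneg (x - c))]
  linarith

/-- The tangent line at the mean `c` is integrated; its linear term has mean zero. -/
theorem logb_one_add_inv_integral_le [IsProbabilityMeasure μ] {X : Ω → ℝ}
    (hX : ∀ᵐ ω ∂μ, 0 < X ω) (hi : Integrable X μ)
    (hl : Integrable (fun ω => Real.logb 2 (1 + (X ω)⁻¹)) μ) :
    Real.logb 2 (1 + (∫ ω, X ω ∂μ)⁻¹) ≤ ∫ ω, Real.logb 2 (1 + (X ω)⁻¹) ∂μ := by
  set c := ∫ ω, X ω ∂μ with hc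
  have hc0 : 0 < c := by
    rw [hc, integral_pos_iff_support_of_nonneg_ae (hX.mono fun _ h => h.le) hi]
    have h1 : μ (Function.support X) = μ Set.univ := by
      refine measure_congr (Filter.eventuallyEq_univ.2 ?_)
      filter_upwards [hX] with ω h using h.ne'
    rw [h1, measure_univ]
    exact one_pos
  have hlog2 : 0 < Real.log 2 := Real.log_pos one_lt_two
  have hXc : Integrable (fun ω => (Real.log 2 * (c * (1 + c)))⁻¹ * (X ω - c)) μ :=
    (hi.sub (integrable_const c)).const_mul _
  have hg : Integrable (fun ω => Real.logb 2 (1 + c⁻¹)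
      - (Real.log 2 * (c * (1 + c)))⁻¹ * (X ω - c)) μ :=
    (integrable_const _).sub hXc
  have h1 : ∫ ω, (Real.logb 2 (1 + c⁻¹) - (Real.log 2 * (c * (1 + c)))⁻¹ * (X ω - c)) ∂μ
      = Real.logb 2 (1 + c⁻¹) := by
    rw [integral_sub (integrable_const _) hXc,
      integral_const_mul, integral_sub hi (integrable_const c)]
    simp [← hc]
  rw [← h1]
  refine integral_mono_ae hg hl ?_
  filter_upwards [hX] with ω hω
  have h2 := log_one_add_inv_ge hω hc0
  simp only [Real.logb]
  calc _ = (Real.log (1 + c⁻¹) - (X ω - c) / (c * (1 + c))) / Real.log 2 := by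
        field_simp
    _ ≤ _ := by gcongr

/-! ### The inverse SINR and its average over the forward coefficients. -/

/-- The factor of the inverse SINR that depends on the forward coefficients only. -/
noncomputable def noiseFactor (P : Params K) (method : Method) (k : Fin K) (h : Fin K → ℂ) : ℝ :=
  (‖h k‖ ^ 2 * (∑ i ∈ Finset.univ.erase k,
      P.p i * cutErrVar P.τ (P.errVar method i) (h i) + P.σ2)
    + P.p k * P.errVar method k) / P.p k

@[fun_prop]
theorem measurable_cutErrVar (τ s : ℝ) : Measurable (cutErrVar τ s) := by
  unfold cutErrVar backwardErrVar
  exact Measurable.ite (measurableSet_le (by fun_prop) (by fun_prop)) (by fun_prop) (by fun_prop)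

@[fun_prop]
theorem measurable_noiseFactor (P : Params K) (method : Method) (k : Fin K) :
    Measurable (noiseFactor P method k) := by
  unfold noiseFactor
  fun_prop

theorem cutErrVar_nonneg (τ : ℝ) {s : ℝ} (hs : 0 ≤ s) (z : ℂ) : 0 ≤ cutErrVar τ s z := by
  unfold cutErrVar backwardErrVar
  split_ifs <;> positivity

theorem cutErrVar_le {τ s : ℝ} (hτ : 0 < τ) (hs : 0 ≤ s) (z : ℂ) : cutErrVar τ s z ≤ s / τ := by
  unfold cutErrVar backwardErrVar
  split_ifs
  · gcongr
  · positivity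

/-- This keeps the factor away from zero uniformly, which gives both positivity and an upper bound
on the SINR. -/
theorem errVar_le_noiseFactor (P : Params K) (hD : 0 < P.D) (method : Method) (k : Fin K)
    (h : Fin K → ℂ) : P.errVar method k ≤ noiseFactor P method k h := by
  have hs := P.errVar_pos hD method
  rw [noiseFactor, le_div_iff₀ (P.p_pos k)]
  have h1 : 0 ≤ ∑ i ∈ Finset.univ.erase k, P.p i * cutErrVar P.τ (P.errVar method i) (h i) :=
    Finset.sum_nonneg fun i _ => mul_nonneg (P.p_pos i).le (cutErrVar_nonneg _ (hs i).le _)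
  nlinarith [mul_nonneg (sq_nonneg ‖h k‖) (add_nonneg h1 P.σ2_pos.le)]

/-- Only the signal survives the detector, with power `p_k / |h_k|²`. Dividing by it cancels the
singular `1 / |h_k|²` in the error variance of tag `k`, so this tag needs no cut-off. -/
theorem invSinr_eq {Ω : Type*} (P : Params K) (method : Method) {hf : Fin M → Fin K → Ω → ℂ}
    {Hhat : Fin K → Ω → Matrix (Fin R) (Fin M) ℂ} {m : Fin M} (k : Fin K) {ω : Ω}
    (hdet : IsUnit ((antennaEstimate Hhat m ω)ᴴ * antennaEstimate Hhat m ω).det)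
    (hk : hf m k ω ≠ 0) :
    invSinr P method hf Hhat m k ω =
      zfNoiseGain (antennaEstimate Hhat m ω) k * noiseFactor P method k (fun i => hf m i ω) := by
  -- For `i ≠ k` the numerator is 0, so a vanishing `hf m i ω` does no harm.
  have hq : ∀ i, star (zfColumn Hhat m k ω) ⬝ᵥ backwardEstimate hf Hhat m i ω
      = (if k = i then 1 else 0) / hf m i ω := by
    intro i
    rw [← star_zfDetector_dotProduct hdet k i, dotProduct, dotProduct, Finset.sum_div]
    exact Finset.sum_congr rfl fun r _ => by
      simp only [backwardEstimate, zfColumn, Matrix.col_apply]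
      ring
  have hp := P.p_pos k
  have hk' : ‖hf m k ω‖ ≠ 0 := norm_ne_zero_iff.2 hk
  have hs : signalPower P hf Hhat m k ω = P.p k / ‖hf m k ω‖ ^ 2 := by
    rw [signalPower, hq, if_pos rfl, norm_div, norm_one]
    ring
  have hn : noisePower P method hf Hhat m k ω = zfNoiseGain (antennaEstimate Hhat m ω) k *
      (∑ i ∈ Finset.univ.erase k, P.p i * cutErrVar P.τ (P.errVar method i) (hf m i ω)
        + P.p k * (P.errVar method k / ‖hf m k ω‖ ^ 2) + P.σ2) := by
    have h0 : ∑ i ∈ Finset.univ.erase k,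
        P.p i * ‖star (zfColumn Hhat m k ω) ⬝ᵥ backwardEstimate hf Hhat m i ω‖ ^ 2 = 0 := by
      refine Finset.sum_eq_zero fun i hi => ?_
      rw [hq, if_neg (Finset.ne_of_mem_erase hi).symm]
      simp
    simp only [noisePower]
    rw [h0, zero_add, ← mul_add]
    rfl
  rw [invSinr, hs, hn, noiseFactor]
  field_simp
  ring

/-- With `V = s / (β|h|² + s)` and `U = |h|² / (β|h|² + s) = (1 - V) / β`, the integrand is affine
in `U` and `V`, with the cut-off terms as coefficients of `U`. Those terms involve other tags and
are independent of `U`, so the means multiply. The constant `c` is `R - K` in the application. -/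
theorem integral_noiseFactor_div [IsProbabilityMeasure μ] (P : Params K) (hD : 0 < P.D)
    (method : Method) (k : Fin K) {X : Fin K → Ω → ℂ} (hX : IsIndepCN X P.β μ) (c : ℝ) :
    Integrable (fun ω => noiseFactor P method k (fun i => X i ω) *
      ((P.β k * ‖X k ω‖ ^ 2 + P.errVar method k) * c)⁻¹) μ ∧
    ∫ ω, noiseFactor P method k (fun i => X i ω) *
        ((P.β k * ‖X k ω‖ ^ 2 + P.errVar method k) * c)⁻¹ ∂μ
      = ((1 - phi P method k) * (∑ i ∈ Finset.univ.erase k,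
            P.p i * (P.errVar method i / P.β i) * gammaZero (P.τ / P.β i) + P.σ2)
          + P.p k * P.β k * phi P method k) / (P.p k * c * P.β k) := by
  have hs := P.errVar_pos hD method
  set s := P.errVar method with hsdef
  have hβ := P.β_pos
  have hp := P.p_pos
  let V : ℂ → ℝ := fun z => 1 / (P.β k * ‖z‖ ^ 2 / s k + 1)
  let U : ℂ → ℝ := fun z => (1 - V z) / P.β k
  have hXm : ∀ i, AEMeasurable (X i) μ := fun i => (hX.law i).aemeasurable
  have hVm : Measurable V := by fun_prop
  have hUm : Measurable U := by fun_prop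
  have hV0 : ∀ z, 0 ≤ V z := fun z => by
    have h1 := hβ k
    have h2 := hs k
    positivity
  have hV1 : ∀ z, V z ≤ 1 := fun z => by
    have h1 := hβ k
    have h2 := hs k
    refine div_le_one_of_le₀ ?_ (by positivity)
    have : 0 ≤ P.β k * ‖z‖ ^ 2 / s k := by positivity
    linarith
  have hVi : Integrable (fun ω => V (X k ω)) μ := by
    refine Integrable.of_bound (C := 1) (hVm.comp_aemeasurable (hXm k)).aestronglyMeasurable
      (.of_forall fun ω => ?_)
    rw [Real.norm_eq_abs, abs_of_nonneg (hV0 _)]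
    exact hV1 _
  have hUi : Integrable (fun ω => U (X k ω)) μ := ((integrable_const 1).sub hVi).div_const _
  have hVint : ∫ ω, V (X k ω) ∂μ = phi P method k :=
    (hX.law k).integral_comp hVm.aestronglyMeasurable
  have hUint : ∫ ω, U (X k ω) ∂μ = (1 - phi P method k) / P.β k := by
    simp only [U]
    rw [integral_div, integral_sub (integrable_const 1) hVi, hVint]
    simp
  have hTm : ∀ i, Measurable (cutErrVar P.τ (s i)) := fun i => measurable_cutErrVar _ _
  have hTi : ∀ i, Integrable (fun ω => cutErrVar P.τ (s i) (X i ω)) μ := fun i => by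
    refine Integrable.of_bound (C := s i / P.τ)
      ((hTm i).comp_aemeasurable (hXm i)).aestronglyMeasurable (.of_forall fun ω => ?_)
    rw [Real.norm_eq_abs, abs_of_nonneg (cutErrVar_nonneg _ (hs i).le _)]
    exact cutErrVar_le P.τ_pos (hs i).le _
  have hTint : ∀ i, ∫ ω, cutErrVar P.τ (s i) (X i ω) ∂μ
      = s i / P.β i * gammaZero (P.τ / P.β i) := fun i => by
    rw [← integral_cutErrVar (hβ i) P.τ_pos]
    exact (hX.law i).integral_comp (hTm i).aestronglyMeasurable
  have hind : ∀ i, i ≠ k → IndepFun (fun ω => U (X k ω))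
      (fun ω => cutErrVar P.τ (s i) (X i ω)) μ := fun i hi =>
    (hX.indep.indepFun hi.symm).comp hUm (hTm i)
  have hUTi : ∀ i ∈ Finset.univ.erase k,
      Integrable (fun ω => P.p i * (U (X k ω) * cutErrVar P.τ (s i) (X i ω))) μ := fun i hi =>
    ((hind i (Finset.ne_of_mem_erase hi)).integrable_mul hUi (hTi i)).const_mul _
  have heq : ∀ ω, noiseFactor P method k (fun i => X i ω) *
      ((P.β k * ‖X k ω‖ ^ 2 + s k) * c)⁻¹ = (P.p k * c)⁻¹ *
        (∑ i ∈ Finset.univ.erase k, P.p i * (U (X k ω) * cutErrVar P.τ (s i) (X i ω))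
          + P.σ2 * U (X k ω) + P.p k * V (X k ω)) := by
    intro ω
    have h1 := hβ k
    have h2 := hs k
    have h3 := hp k
    have h4 : 0 < P.β k * ‖X k ω‖ ^ 2 + s k := by positivity
    have hVe : V (X k ω) = s k / (P.β k * ‖X k ω‖ ^ 2 + s k) := by
      simp only [V]
      field_simp
    have hUe : U (X k ω) = ‖X k ω‖ ^ 2 / (P.β k * ‖X k ω‖ ^ 2 + s k) := by
      simp only [U, hVe]
      field_simp
      ring
    have hsum : ∑ i ∈ Finset.univ.erase k, P.p i * (U (X k ω) * cutErrVar P.τ (s i) (X i ω))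
        = U (X k ω) * ∑ i ∈ Finset.univ.erase k, P.p i * cutErrVar P.τ (s i) (X i ω) := by
      rw [Finset.mul_sum]
      exact Finset.sum_congr rfl fun i _ => by ring
    rw [hsum, noiseFactor, ← hsdef, hVe, hUe, mul_inv, mul_inv]
    field_simp
  simp_rw [heq]
  have hSi := integrable_finsetSum _ hUTi
  have hSUi : Integrable (fun ω => ∑ i ∈ Finset.univ.erase k,
      P.p i * (U (X k ω) * cutErrVar P.τ (s i) (X i ω)) + P.σ2 * U (X k ω)) μ :=
    hSi.add (hUi.const_mul _)
  refine ⟨(hSUi.add (hVi.const_mul _)).const_mul _, ?_⟩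
  rw [integral_const_mul, integral_add hSUi (hVi.const_mul _),
    integral_add hSi (hUi.const_mul _), integral_finsetSum _ hUTi, integral_const_mul,
    integral_const_mul, hUint, hVint]
  have hsum : ∑ i ∈ Finset.univ.erase k,
      ∫ ω, P.p i * (U (X k ω) * cutErrVar P.τ (s i) (X i ω)) ∂μ
      = (1 - phi P method k) / P.β k * ∑ i ∈ Finset.univ.erase k,
        P.p i * (s i / P.β i) * gammaZero (P.τ / P.β i) := by
    rw [Finset.mul_sum]
    refine Finset.sum_congr rfl fun i hi => ?_
    rw [integral_const_mul, (hind i (Finset.ne_of_mem_erase hi)).integral_fun_mul_eq_mul_integral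
      hUi.aestronglyMeasurable (hTi i).aestronglyMeasurable, hUint, hTint]
    ring
  rw [hsum]
  have h1 := (hβ k).ne'
  have h3 := (hp k).ne'
  -- For `c = 0` both sides are 0 by the convention on division.
  by_cases hc : c = 0
  · simp [hc]
  · field_simp

end WPBC

/-! ### The closed form and the lower bound on the rate. -/

theorem proposition3 {K M R : ℕ} (hR : K + 1 ≤ R) (P : WPBC.Params K) (method : WPBC.Method)
    (G : Matrix (Fin P.D) (Fin M) ℂ) (hG : Gᴴ * G = 1)
    {Ω : Type*} [MeasurableSpace Ω] (μ : Measure Ω) [IsProbabilityMeasure μ]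
    (hf : Fin M → Fin K → Ω → ℂ) (hb : Fin K → Fin R → Ω → ℂ)
    (Hhat : Fin K → Ω → Matrix (Fin R) (Fin M) ℂ)
    (hest : WPBC.IsEstimate P G hf hb Hhat μ method)
    (m : Fin M) (k : Fin K) :
    (∀ᵐ ω ∂μ, IsUnit
      ((WPBC.antennaEstimate Hhat m ω)ᴴ * WPBC.antennaEstimate Hhat m ω).det) ∧
    Integrable (fun ω => WPBC.invSinr P method hf Hhat m k ω) μ ∧
    WPBC.jensenRate P method hf Hhat m k μ = Real.logb 2 (1 + WPBC.zfSinr P method R k) ∧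
    Integrable (fun ω => Real.logb 2 (1 + WPBC.sinr P method hf Hhat m k ω)) μ ∧
    WPBC.jensenRate P method hf Hhat m k μ ≤ WPBC.ergodicRate P method hf Hhat m k μ := by
  obtain ⟨D, E, vE, c, hind, hvE, hc, hH⟩ := hest.exists_eq_add_sum hG m
  have hD := WPBC.Params.D_pos_of_isometry hG m
  have hs := P.errVar_pos hD method
  have hβ := P.β_pos
  have hfm : ∀ i, AEMeasurable (hf m i) μ := fun i => (hind.law (.inl (m, i))).aemeasurable
  have hbm : ∀ i r, AEMeasurable (hb i r) μ := fun i r =>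
    (hind.law (.inr (.inl (i, r)))).aemeasurable
  have hEm : ∀ i r d, AEMeasurable (E i r d) μ := fun i r d =>
    (hind.law (.inr (.inr (i, r, d)))).aemeasurable
  have hX : WPBC.IsIndepCN (hf m) P.β μ := by
    refine ⟨fun i => hind.law (.inl (m, i)), ?_⟩
    refine hind.indep.precomp (g := fun i => Sum.inl (m, i)) fun i j hij => ?_
    simpa using hij
  let x : Ω → Fin K → ℂ := fun ω i => hf m i ω
  let a : Ω → Fin K → Fin R → ℂ := fun ω i r => hf m i ω * hb i r ω + ∑ d, c i d * E i r d ω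
  have hxm : AEMeasurable x μ := aemeasurable_pi_lambda _ hfm
  have ham : AEMeasurable a μ := by
    refine aemeasurable_pi_lambda _ fun i => aemeasurable_pi_lambda _ fun r => ?_
    exact ((hfm i).mul (hbm i r)).add
      (Finset.aemeasurable_fun_sum _ fun d _ => (hEm i r d).const_mul _)
  have hA : ∀ ω, WPBC.antennaEstimate Hhat m ω = Matrix.of fun r i => a ω i r := by
    intro ω
    ext r i
    exact hH i r ω
  -- The conditional variance of the entries of column `i` given the forward coefficients.
  let w : Ω → Fin K → ℝ := fun ω i => P.β i * ‖hf m i ω‖ ^ 2 + P.errVar method i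
  have hw : ∀ ω i, 0 < w ω i := fun ω i => by
    have h1 := hβ i
    have h2 := hs i
    positivity
  have hlaw : ∀ {F : (Fin K → ℂ) → (Fin K → Fin R → ℂ) → ENNReal},
      Measurable (Function.uncurry F) → ∫⁻ ω, F (x ω) (a ω) ∂μ = ∫⁻ ω, ∫⁻ b, F (x ω) b
        ∂(Measure.pi fun i => Measure.pi fun _ => WPBC.complexGaussian (w ω i)) ∂μ := by
    intro F hF
    have h := hind.lintegral_estimate (c := c) hβ hvE m hF
    simp only [hc] at h
    exact h
  have hRK : (0 : ℝ) < R - K := by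
    have : (K : ℝ) + 1 ≤ R := by exact_mod_cast hR
    linarith
  have hLI : ∀ᵐ ω ∂μ, LinearIndependent ℂ (a ω) := by
    have hms : MeasurableSet {b : Fin K → Fin R → ℂ | LinearIndependent ℂ b} :=
      (isOpen_setOfPred_linearIndependent (𝕜 := ℂ)).measurableSet
    -- The probability of linear dependence is the mean of its conditional probability, which is
    -- zero for every value of the forward coefficients.
    have h := hlaw (F := fun _ b => Set.indicator {b | LinearIndependent ℂ b}ᶜ 1 b)
      ((measurable_one.indicator hms.compl).comp measurable_snd)
    have h0 : ∀ ω, ∫⁻ b, Set.indicator {b : Fin K → Fin R → ℂ | LinearIndependent ℂ b}ᶜ 1 b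
        ∂(Measure.pi fun i => Measure.pi fun _ => WPBC.complexGaussian (w ω i)) = 0 := by
      intro ω
      rw [lintegral_indicator_one hms.compl]
      exact WPBC.ae_linearIndependent_pi_complexGaussian hR (hw ω)
    simp_rw [h0, lintegral_zero] at h
    have hma : AEMeasurable (fun ω => Set.indicator {b : Fin K → Fin R → ℂ |
        LinearIndependent ℂ b}ᶜ (1 : (Fin K → Fin R → ℂ) → ENNReal) (a ω)) μ :=
      (measurable_one.indicator hms.compl).comp_aemeasurable ham
    rw [lintegral_eq_zero_iff' hma] at h
    filter_upwards [h] with ω hω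
    by_contra hn
    simp [Set.indicator_of_mem (show a ω ∈ {b | LinearIndependent ℂ b}ᶜ from hn)] at hω
  have hdet : ∀ᵐ ω ∂μ, IsUnit
      ((WPBC.antennaEstimate Hhat m ω)ᴴ * WPBC.antennaEstimate Hhat m ω).det := by
    filter_upwards [hLI] with ω hω
    rw [hA]
    exact WPBC.isUnit_det_conjTranspose_mul_self hω
  have hk0 : ∀ᵐ ω ∂μ, hf m k ω ≠ 0 :=
    ((hX.law k).ae_iff (p := fun z => z ≠ 0) (by fun_prop)).2
      (WPBC.ae_ne_zero_complexGaussian (hβ k))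
  let gain : (Fin K → Fin R → ℂ) → ℝ := fun b => WPBC.zfNoiseGain (Matrix.of fun r i => b i r) k
  have hgain : Measurable gain :=
    WPBC.measurable_zfNoiseGain (fun r i => by simp only [Matrix.of_apply]; fun_prop) k
  have hinv : ∀ᵐ ω ∂μ, WPBC.invSinr P method hf Hhat m k ω =
      gain (a ω) * WPBC.noiseFactor P method k (x ω) := by
    filter_upwards [hdet, hk0] with ω h1 h2
    rw [WPBC.invSinr_eq P method k h1 h2, hA]
  have hNpos : ∀ h, 0 < WPBC.noiseFactor P method k h := fun h =>
    (hs k).trans_le (WPBC.errVar_le_noiseFactor P hD method k h)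
  have hNm : Measurable (WPBC.noiseFactor P method k) := WPBC.measurable_noiseFactor P method k
  have hpos : ∀ᵐ ω ∂μ, 0 < WPBC.invSinr P method hf Hhat m k ω := by
    filter_upwards [hinv, hLI] with ω h1 h2
    rw [h1]
    exact mul_pos (WPBC.zfNoiseGain_pos (A := Matrix.of fun r i => a ω i r) h2 k) (hNpos _)
  have hinvm : AEStronglyMeasurable (fun ω => WPBC.invSinr P method hf Hhat m k ω) μ :=
    ((hgain.comp_aemeasurable ham).mul (hNm.comp_aemeasurable hxm)).aestronglyMeasurable.congr
      (hinv.mono fun _ h => h.symm)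
  obtain ⟨hYi, hYint⟩ := WPBC.integral_noiseFactor_div P hD method k hX ((R : ℝ) - K)
  have hY0 : ∀ ω, 0 ≤ WPBC.noiseFactor P method k (fun i => hf m i ω) *
      ((P.β k * ‖hf m k ω‖ ^ 2 + P.errVar method k) * ((R : ℝ) - K))⁻¹ := fun ω =>
    mul_nonneg (hNpos _).le (inv_nonneg.2 (mul_pos (hw ω k) hRK).le)
  -- The noise amplification is replaced by its conditional mean `1 / (w_k (R - K))`. Working with
  -- `∫⁻` makes the integrability of the inverse SINR a consequence of this identity.
  have hlint : ∫⁻ ω, ENNReal.ofReal (WPBC.invSinr P method hf Hhat m k ω) ∂μ =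
      ENNReal.ofReal (∫ ω, WPBC.noiseFactor P method k (fun i => hf m i ω) *
        ((P.β k * ‖hf m k ω‖ ^ 2 + P.errVar method k) * ((R : ℝ) - K))⁻¹ ∂μ) := by
    rw [ofReal_integral_eq_lintegral_ofReal hYi (.of_forall hY0)]
    calc ∫⁻ ω, ENNReal.ofReal (WPBC.invSinr P method hf Hhat m k ω) ∂μ
        = ∫⁻ ω, ENNReal.ofReal (WPBC.noiseFactor P method k (x ω)) *
            ENNReal.ofReal (gain (a ω)) ∂μ := by
          refine lintegral_congr_ae ?_
          filter_upwards [hinv] with ω h1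
          rw [h1, mul_comm, ENNReal.ofReal_mul (hNpos _).le]
      _ = ∫⁻ ω, ∫⁻ b, ENNReal.ofReal (WPBC.noiseFactor P method k (x ω)) *
            ENNReal.ofReal (gain b)
            ∂(Measure.pi fun i => Measure.pi fun _ => WPBC.complexGaussian (w ω i)) ∂μ :=
          hlaw (F := fun h b => ENNReal.ofReal (WPBC.noiseFactor P method k h) *
            ENNReal.ofReal (gain b))
            ((hNm.comp measurable_fst).ennreal_ofReal.mul (hgain.comp measurable_snd).ennreal_ofReal)
      _ = _ := by
          refine lintegral_congr fun ω => ?_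
          rw [lintegral_const_mul _ hgain.ennreal_ofReal,
            WPBC.lintegral_zfNoiseGain hR (hw ω) k, ← ENNReal.ofReal_mul (hNpos _).le]
  have hint : Integrable (fun ω => WPBC.invSinr P method hf Hhat m k ω) μ := by
    refine ⟨hinvm, ?_⟩
    rw [hasFiniteIntegral_iff_ofReal (hpos.mono fun _ h => h.le), hlint]
    exact ENNReal.ofReal_lt_top
  have hexp : ∫ ω, WPBC.invSinr P method hf Hhat m k ω ∂μ =
      ∫ ω, WPBC.noiseFactor P method k (fun i => hf m i ω) *
        ((P.β k * ‖hf m k ω‖ ^ 2 + P.errVar method k) * ((R : ℝ) - K))⁻¹ ∂μ := by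
    rw [integral_eq_lintegral_of_nonneg_ae (hpos.mono fun _ h => h.le) hinvm, hlint,
      ENNReal.toReal_ofReal (integral_nonneg hY0)]
  have hsinr : ∀ ω, WPBC.sinr P method hf Hhat m k ω =
      (WPBC.invSinr P method hf Hhat m k ω)⁻¹ := fun ω => (inv_div _ _).symm
  -- Up to a constant this dominates the rate: `log (1 + γ) ≤ γ`, and `γ` is at most the squared
  -- norm of column `k` divided by its error variance.
  have hcol : Integrable (fun ω => ∑ r, ‖a ω k r‖ ^ 2) μ := by
    have hmeas : Measurable fun b : Fin K → Fin R → ℂ => ∑ r, ENNReal.ofReal (‖b k r‖ ^ 2) := by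
      fun_prop
    refine ⟨(Measurable.comp_aemeasurable (g := fun b : Fin K → Fin R → ℂ => ∑ r, ‖b k r‖ ^ 2)
      (by fun_prop) ham).aestronglyMeasurable, ?_⟩
    rw [hasFiniteIntegral_iff_ofReal (.of_forall fun ω => Finset.sum_nonneg fun _ _ => sq_nonneg _)]
    have h1 : ∀ ω, ENNReal.ofReal (∑ r, ‖a ω k r‖ ^ 2) = ∑ r, ENNReal.ofReal (‖a ω k r‖ ^ 2) :=
      fun ω => ENNReal.ofReal_sum_of_nonneg fun _ _ => sq_nonneg _
    simp_rw [h1]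
    rw [hlaw (F := fun _ b => ∑ r, ENNReal.ofReal (‖b k r‖ ^ 2)) (hmeas.comp measurable_snd)]
    have h2 : ∀ ω, ∫⁻ b : Fin K → Fin R → ℂ, ∑ r, ENNReal.ofReal (‖b k r‖ ^ 2)
        ∂(Measure.pi fun i => Measure.pi fun _ => WPBC.complexGaussian (w ω i))
        = R * (ENNReal.ofReal (P.β k) * ENNReal.ofReal (‖hf m k ω‖ ^ 2)
          + ENNReal.ofReal (P.errVar method k)) := by
      intro ω
      rw [lintegral_finsetSum _ (by fun_prop)]
      have h3 : ∀ r, ∫⁻ b : Fin K → Fin R → ℂ, ENNReal.ofReal (‖b k r‖ ^ 2)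
          ∂(Measure.pi fun i => Measure.pi fun _ => WPBC.complexGaussian (w ω i))
          = ENNReal.ofReal (w ω k) := by
        intro r
        rw [← WPBC.lintegral_sq_norm_complexGaussian (hw ω k).le]
        have hmp := (measurePreserving_eval (fun _ : Fin R => WPBC.complexGaussian (w ω k)) r).comp
          (measurePreserving_eval
            (fun i => Measure.pi fun _ : Fin R => WPBC.complexGaussian (w ω i)) k)
        exact hmp.lintegral_comp (f := fun z : ℂ => ENNReal.ofReal (‖z‖ ^ 2)) (by fun_prop)
      simp_rw [h3]
      rw [Finset.sum_const, Finset.card_univ, Fintype.card_fin, nsmul_eq_mul,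
        ← ENNReal.ofReal_mul (hβ k).le, ← ENNReal.ofReal_add (by have := hβ k; positivity) (hs k).le]
    simp_rw [h2]
    rw [lintegral_const_mul' _ _ (ENNReal.natCast_ne_top R), lintegral_add_right' _ (by fun_prop),
      lintegral_const_mul' _ _ ENNReal.ofReal_ne_top,
      (hX.law k).lintegral_comp (f := fun z : ℂ => ENNReal.ofReal (‖z‖ ^ 2)) (by fun_prop),
      WPBC.lintegral_sq_norm_complexGaussian (hβ k).le, lintegral_const, measure_univ, mul_one]
    exact ENNReal.mul_lt_top (ENNReal.natCast_lt_top R) (ENNReal.add_lt_top.2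
      ⟨ENNReal.mul_lt_top ENNReal.ofReal_lt_top ENNReal.ofReal_lt_top, ENNReal.ofReal_lt_top⟩)
  have hlog2 : 0 < Real.log 2 := Real.log_pos one_lt_two
  have hlogint : Integrable (fun ω =>
      Real.logb 2 (1 + (WPBC.invSinr P method hf Hhat m k ω)⁻¹)) μ := by
    refine (hcol.const_mul ((P.errVar method k)⁻¹ / Real.log 2)).mono' ?_ ?_
    · exact (Measurable.comp_aemeasurable (g := fun y : ℝ => Real.logb 2 (1 + y⁻¹))
        (by unfold Real.logb; fun_prop) hinvm.aemeasurable).aestronglyMeasurable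
    · filter_upwards [hinv, hpos, hLI] with ω h1 h2 h3
      have h4 : (WPBC.invSinr P method hf Hhat m k ω)⁻¹ ≤
          (P.errVar method k)⁻¹ * ∑ r, ‖a ω k r‖ ^ 2 := by
        rw [h1, mul_inv, mul_comm]
        have h5 := WPBC.inv_zfNoiseGain_le (A := Matrix.of fun r i => a ω i r) h3 k
        have h6 := WPBC.errVar_le_noiseFactor P hD method k (x ω)
        have h7 := hs k
        have h8 := (WPBC.zfNoiseGain_pos (A := Matrix.of fun r i => a ω i r) h3 k)
        exact mul_le_mul (inv_anti₀ h7 h6) h5 (inv_nonneg.2 h8.le) (inv_nonneg.2 h7.le)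
      have h9 : 0 < (WPBC.invSinr P method hf Hhat m k ω)⁻¹ := inv_pos.2 h2
      rw [Real.norm_eq_abs, abs_of_nonneg (Real.logb_nonneg one_lt_two (by linarith)), Real.logb,
        div_mul_eq_mul_div]
      gcongr
      have h10 := Real.log_le_sub_one_of_pos
        (show 0 < 1 + (WPBC.invSinr P method hf Hhat m k ω)⁻¹ by linarith)
      linarith
  refine ⟨hdet, hint, ?_, ?_, ?_⟩
  · rw [WPBC.jensenRate, hexp, hYint, WPBC.zfSinr, inv_div]
  · simp_rw [hsinr]
    exact hlogint
  · simp only [WPBC.jensenRate, WPBC.ergodicRate, hsinr]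
    exact WPBC.logb_one_add_inv_integral_le hpos hint hlogint
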